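/- Let $q$ be a prime and $\log=\log_2$. For every $n$ let $0\le k_2^{(n)}\le k_1^{(n)}\le n$ be integers such that the limits $R_j=\lim_{n\to\infty}\frac{k_j^{(n)}}{n}\log q$, $j=1,2$, exist, and let $d^{(n)}\in\mathbb F_q^n$ be a fixed vector. For $Q\in\mathbb F_q^{(n-k_1)\times k_1}$ and $H\in\mathbb F_q^{(k_1-k_2)\times k_2}$ consider the nested systematic linear codes $$\mathcal C_1=\left\{\begin{bmatrix} I\\ Q\end{bmatrix} m : m\in\mathbb F_q^{k_1}\right\},\qquad \mathcal C_2=\left\{\begin{bmatrix} I\\ Q\end{bmatrix}\begin{bmatrix} n'\\ Hn'\end{bmatrix} : n'\in\mathbb F_q^{k_2}\right\}$$ (of sizes $q^{k_1}$ and $q^{k_2}$) and the coset $\mathcal C_1'=\mathcal C_1\oplus d^{(n)}$, where $\oplus$ is addition modulo $q$. View $\mathcal C_1'$ and $\mathcal C_2$ as sets of integer vectors with entries in $\{0,\dots,q-1\}$, let $\mathcal C_1'+\mathcal C_2$ be their sumset with respect to addition in $\mathbb Z^n$, and let $P_{\mathcal S}$ be the distribution of $T_1+T_2$ on it, where $T_1,T_2$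 are independent and uniformly distributed on $\mathcal C_1'$ and $\mathcal C_2$. Put $D(q)=H(U_1+U_2)-\log q$, where $H(\cdot)$ is the entropy in bits and $U_1,U_2$ are independent and uniform on $\{0,\dots,q-1\}$ (added in $\mathbb Z$). Let the entries of $Q$ and $H$ be i.i.d. uniform on $\mathbb F_q$. Then asymptotically almost surely $\mathcal C_1'$ and $\mathcal C_2$ have a normal typical sumset. Precisely, there are deterministic sequences $\varepsilon_n\searrow 0$ and $\eta_n\to 0$ such that the probability, over $(Q,H)$, of the following event tends to $1$ as $n\to\infty$: there is a set $\mathcal K_N\subseteq\mathcal C_1'+\mathcal C_2$ with $P_{\mathcal S}(\mathcal K_N)\ge 1-\eta_n$, $$2^{-n\varepsilon_n}A_n\le|\mathcal K_N|\le 2^{n\varepsilon_n}A_n,\qquad A_n=\min\left\{2^{n(R_1+R_2)},\,2^{n(\max\{R_1,R_2\}+D(q))}\right\},$$ and, for all $w\in\mathcal K_N$, $$2^{-n\varepsilon_n}B_n\le P_{\mathcal S}(w)\le 2^{n\varepsilon_n}B_n,\qquad B_n=\max\left\{2^{-n(R_1+R_2)},\,2^{-n(\max\{R_1,R_2\}+D(q))}\right\}.$$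 -/

import Mathlib

open Filter Topology
open scoped Pointwise Matrix

noncomputable section

/-- Positions of a message of length `k₁`, split into the first `k₂` and the remaining
`k₁ - k₂` ones (used for `k₂ ≤ k₁`). -/
abbrev MsgIdx (k₁ k₂ : ℕ) : Type := Fin k₂ ⊕ Fin (k₁ - k₂)

/-- Positions of a codeword of length `n`: the `k₁` message positions, followed by the
`n - k₁` parity positions (used for `k₂ ≤ k₁ ≤ n`). -/
abbrev CodeIdx (n k₁ k₂ : ℕ) : Type := MsgIdx k₁ k₂ ⊕ Fin (n - k₁)

/-- The systematic code `{[I; Q] m : m ∈ 𝔽_q^{k₁}}`. -/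
def code₁ {q n k₁ k₂ : ℕ} [NeZero q]
    (Q : Matrix (Fin (n - k₁)) (MsgIdx k₁ k₂) (ZMod q)) :
    Finset (CodeIdx n k₁ k₂ → ZMod q) :=
  Finset.univ.image fun m : MsgIdx k₁ k₂ → ZMod q => Matrix.fromRows 1 Q *ᵥ m

/-- The nested systematic code `{[I; Q] [n'; H n'] : n' ∈ 𝔽_q^{k₂}}`. -/
def code₂ {q n k₁ k₂ : ℕ} [NeZero q]
    (Q : Matrix (Fin (n - k₁)) (MsgIdx k₁ k₂) (ZMod q))
    (H : Matrix (Fin (k₁ - k₂)) (Fin k₂) (ZMod q)) :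
    Finset (CodeIdx n k₁ k₂ → ZMod q) :=
  Finset.univ.image fun n' : Fin k₂ → ZMod q => Matrix.fromRows 1 Q *ᵥ Sum.elim n' (H *ᵥ n')

/-- The coset `C ⊕ d`, with addition modulo `q`. -/
def coset {q : ℕ} {ι : Type} [Fintype ι] (C : Finset (ι → ZMod q)) (d : ι → ZMod q) :
    Finset (ι → ZMod q) :=
  C.image fun t => t + d

/-- A set of vectors over `𝔽_q`, viewed as a set of integer vectors with entries in
`{0, …, q - 1}`. -/
def toInt {q : ℕ} {ι : Type} [Fintype ι] (C : Finset (ι → ZMod q)) : Finset (ι → ℤ) :=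
  C.image fun t i => ((t i).val : ℤ)

theorem toInt_coset_code₁_nonempty {q n k₁ k₂ : ℕ} [NeZero q]
    (Q : Matrix (Fin (n - k₁)) (MsgIdx k₁ k₂) (ZMod q)) (d : CodeIdx n k₁ k₂ → ZMod q) :
    (toInt (coset (code₁ Q) d)).Nonempty := by
  unfold toInt coset code₁
  exact ((Finset.univ_nonempty.image _).image _).image _

theorem toInt_code₂_nonempty {q n k₁ k₂ : ℕ} [NeZero q]
    (Q : Matrix (Fin (n - k₁)) (MsgIdx k₁ k₂) (ZMod q))
    (H : Matrix (Fin (k₁ - k₂)) (Fin k₂) (ZMod q)) :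
    (toInt (code₂ Q H)).Nonempty := by
  unfold toInt code₂
  exact (Finset.univ_nonempty.image _).image _

/-- The distribution of `T₁ + T₂` (addition in `ℤ`), where `T₁` and `T₂` are independent and
uniformly distributed on the finite sets `A` and `B`. -/
def sumDist {ι : Type} (A B : Finset (ι → ℤ)) (hA : A.Nonempty) (hB : B.Nonempty) :
    PMF (ι → ℤ) :=
  (PMF.uniformOfFinset A hA).bind fun t => (PMF.uniformOfFinset B hB).map fun v => t + v

/-- The sumset `C₁' + C₂` (addition in `ℤ`) of the coset `C₁' = C₁ ⊕ d` and `C₂`. -/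
def codeSumset {q n k₁ k₂ : ℕ} [NeZero q]
    (Q : Matrix (Fin (n - k₁)) (MsgIdx k₁ k₂) (ZMod q))
    (H : Matrix (Fin (k₁ - k₂)) (Fin k₂) (ZMod q))
    (d : CodeIdx n k₁ k₂ → ZMod q) : Finset (CodeIdx n k₁ k₂ → ℤ) :=
  toInt (coset (code₁ Q) d) + toInt (code₂ Q H)

/-- The distribution on the sumset `C₁' + C₂` induced by independent uniformly distributed
elements of `C₁' = C₁ ⊕ d` and of `C₂`. -/
def inducedDist {q n k₁ k₂ : ℕ} [NeZero q]
    (Q : Matrix (Fin (n - k₁)) (MsgIdx k₁ k₂) (ZMod q))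
    (H : Matrix (Fin (k₁ - k₂)) (Fin k₂) (ZMod q))
    (d : CodeIdx n k₁ k₂ → ZMod q) : PMF (CodeIdx n k₁ k₂ → ℤ) :=
  sumDist (toInt (coset (code₁ Q) d)) (toInt (code₂ Q H))
    (toInt_coset_code₁_nonempty Q d) (toInt_code₂_nonempty Q H)

/-- The random code ensemble: all entries of `Q` and `H` are independent and uniformly
distributed in `𝔽_q`, i.e. the pair `(Q, H)` is uniformly distributed. -/
def ensemble (q n k₁ k₂ : ℕ) [NeZero q] :
    PMF (Matrix (Fin (n - k₁)) (MsgIdx k₁ k₂) (ZMod q) ×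
      Matrix (Fin (k₁ - k₂)) (Fin k₂) (ZMod q)) :=
  PMF.uniformOfFintype _

/-- The distribution of `W = U₁ + U₂` (addition in `ℤ`), where `U₁` and `U₂` are independent
and uniformly distributed on `{0, …, q - 1}`. -/
def distW (q : ℕ) [NeZero q] : PMF ℤ :=
  (PMF.uniformOfFintype (ZMod q)).bind fun u₁ =>
    (PMF.uniformOfFintype (ZMod q)).map fun u₂ => (u₁.val : ℤ) + (u₂.val : ℤ)

/-- The entropy, in bits, of a distribution with finite support. -/
def entropy (p : PMF ℤ) : ℝ :=
  ∑ᶠ a : ℤ, -((p a).toReal * Real.logb 2 (p a).toReal)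

/-- `D(q) = H(U₁ + U₂) - log₂ q`. -/
def capD (q : ℕ) [NeZero q] : ℝ := entropy (distW q) - Real.logb 2 q

/-- `a` and `b` agree up to a factor `2 ^ (± n ε)`. With a sequence `ε = ε_n` decreasing to `0`
this is equality to first order in the exponent. -/
def ExpClose (n : ℕ) (ε a b : ℝ) : Prop :=
  (2 : ℝ) ^ (-((n : ℝ) * ε)) * b ≤ a ∧ a ≤ (2 : ℝ) ^ ((n : ℝ) * ε) * b

end

/-! Let `t` be the word from `C₂` and `s` the sum modulo `q` of the two chosen words. Because `C₂ ⊆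
C₁`, `s` is uniform on the coset and independent of `t`. The integer sum is `s` plus `q` times the
carry pattern `1[s_i < t_i]`, so it carries exactly the information of `s` and the carries. Hence
`P_S(w) = N / (q ^ k₁ * q ^ k₂)`, where `N` (`collisions`) counts the words of `C₂` having the same
carries against `s` as `t`.

For uniform `s` and `t` the conditional entropy of one carry given the residue is `D(q)`
(`expect_carryInfo`), so by the weak law a typical carry pattern has conditional probability about
`2 ^ (-n D)`. The claim becomes that `N` is about `max 1 (q ^ k₂ * 2 ^ (-n D))` for most choices,
which is `expect_ind_not_collisions_le`. Three estimates give it. The pair `(s, t)` is nearly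
uniform over the ensemble (`expect_ensemble_le`), hence mostly typical. The lower bound on `N` is
deterministic counting: the class weights sum to at most one, so few words lie in small classes of
large weight (`sum_ind_small_class_le`). The upper bound is a first moment: a codeword whose message
is linearly independent of the other two messages collides like a uniform word
(`expect_sum_ind_carry_le`), and at most `q ^ 2` codewords are dependent.

Once almost all the mass sits on points of probability close to `B`, the number of such points is
close to `1 / B = A` (`exists_typical_sumset`). A diagonal argument replaces a fixed tolerance by a
sequence (`exists_antitone_tendsto_one`). -/

open scoped BigOperators

noncomputable section

/-! ### Indicators, uniform averages and second moments. -/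

/-- The real-valued indicator of a proposition. -/
def ind (P : Prop) : ℝ := open Classical in if P then 1 else 0

theorem ind_of {P : Prop} (h : P) : ind P = 1 := if_pos h

theorem ind_of_not {P : Prop} (h : ¬P) : ind P = 0 := if_neg h

theorem ind_nonneg (P : Prop) : 0 ≤ ind P := by
  by_cases h : P <;> simp [ind, h]

theorem ind_le_one (P : Prop) : ind P ≤ 1 := by
  by_cases h : P <;> simp [ind, h]

theorem ind_mono {P P' : Prop} (h : P → P') : ind P ≤ ind P' := by
  by_cases h1 : P
  · rw [ind_of h1, ind_of (h h1)]
  · rw [ind_of_not h1]; exact ind_nonneg _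

theorem ind_and (P P' : Prop) : ind (P ∧ P') = ind P * ind P' := by
  by_cases h : P <;> by_cases h' : P' <;> simp [ind, h, h']

theorem ind_forall {ι : Type*} [Fintype ι] (P : ι → Prop) : ind (∀ i, P i) = ∏ i, ind (P i) := by
  by_cases h : ∀ i, P i
  · rw [ind_of h, Finset.prod_eq_one fun i _ => ind_of (h i)]
  · obtain ⟨i, hi⟩ := not_forall.1 h
    rw [ind_of_not h, Finset.prod_eq_zero (Finset.mem_univ i) (ind_of_not hi)]

theorem sum_ind {α : Type*} [Fintype α] (P : α → Prop) [DecidablePred P] :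
    ∑ a, ind (P a) = (Finset.univ.filter P).card := by
  rw [Finset.card_filter]
  push_cast
  refine Finset.sum_congr rfl fun a _ => ?_
  by_cases h : P a <;> simp [ind, h]

theorem expect_ind {α : Type*} [Fintype α] (P : α → Prop) [DecidablePred P] :
    𝔼 a, ind (P a) = (Finset.univ.filter P).card / (Fintype.card α : ℝ) := by
  rw [Fintype.expect_eq_sum_div_card, sum_ind]

theorem expect_shift {V ζ : Type*} [Fintype V] [AddGroup V] [Fintype ζ] [Nonempty ζ]
    (T : ζ → V) (f : V → ℝ) : 𝔼 v, f v = 𝔼 v, 𝔼 z, f (v + T z) := by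
  rw [Finset.expect_comm]
  have h (z : ζ) : 𝔼 v, f (v + T z) = 𝔼 v, f v :=
    Fintype.expect_equiv (Equiv.addRight (T z)) _ _ fun v => rfl
  simp only [h]
  rw [Fintype.expect_const]

/-- Exchanging `ω i` with the fresh value `a` is an involution on pairs `(ω, a)`, so resampling one
coordinate preserves averages. This plays the role of independence of coordinates. -/
theorem expect_update {ι α : Type*} [Fintype ι] [DecidableEq ι] [Fintype α]
    (i : ι) (f : (ι → α) → ℝ) :
    𝔼 ω, f ω = 𝔼 ω, 𝔼 a, f (Function.update ω i a) := by
  rcases isEmpty_or_nonempty α with hα | hα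
  · have : IsEmpty (ι → α) := ⟨fun ω => hα.elim (ω i)⟩
    simp
  have hinv : Function.Involutive
      (fun p : (ι → α) × α => (Function.update p.1 i p.2, p.1 i)) := by
    rintro ⟨ω, a⟩
    simp
  calc 𝔼 ω, f ω = 𝔼 ω : ι → α, 𝔼 _a : α, f ω := by simp only [Fintype.expect_const]
    _ = 𝔼 p : (ι → α) × α, f p.1 := by
        rw [← Finset.univ_product_univ, Finset.expect_product]
    _ = 𝔼 p : (ι → α) × α, f (Function.update p.1 i p.2) :=
        (Fintype.expect_equiv hinv.toPerm _ _ fun p => rfl).symm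
    _ = _ := by rw [← Finset.univ_product_univ, Finset.expect_product]

theorem expect_apply_coord {ι α : Type*} [Fintype ι] [DecidableEq ι] [Fintype α] [Nonempty α]
    (i : ι) (f : α → ℝ) : 𝔼 ω : ι → α, f (ω i) = 𝔼 a, f a := by
  rw [expect_update i]
  simp only [Function.update_self]
  rw [Fintype.expect_const]

theorem expect_sq_sum {ι α : Type*} [Fintype ι] [DecidableEq ι] [Fintype α] [Nonempty α]
    (g : α → ℝ) (hg : 𝔼 a, g a = 0) :
    𝔼 ω : ι → α, (∑ i, g (ω i)) ^ 2 = Fintype.card ι * 𝔼 a, g a ^ 2 := by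
  have key (i j : ι) : 𝔼 ω : ι → α, g (ω i) * g (ω j) = if i = j then 𝔼 a, g a ^ 2 else 0 := by
    split_ifs with h
    · subst h
      simp only [← sq]
      exact expect_apply_coord i fun a => g a ^ 2
    -- Resampling coordinate `j` averages `g (ω j)` to zero while `g (ω i)` stays fixed, so cross
    -- terms vanish.
    · rw [expect_update j]
      simp only [Function.update_self, Function.update_of_ne h, ← Finset.mul_expect, hg, mul_zero,
        Finset.expect_const_zero]
  simp only [sq, Finset.sum_mul_sum]
  simp only [Finset.expect_sum_comm, key]
  simp [sq]

/-- The weak law of large numbers for uniform words. -/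
theorem expect_ind_deviation_le {ι α : Type*} [Fintype ι] [DecidableEq ι] [Nonempty ι]
    [Fintype α] [Nonempty α]
    (g : α → ℝ) (hg : 𝔼 a, g a = 0) {δ : ℝ} (hδ : 0 < δ) :
    𝔼 ω : ι → α, ind (Fintype.card ι * δ < |∑ i, g (ω i)|) ≤
      (𝔼 a, g a ^ 2) / (Fintype.card ι * δ ^ 2) := by
  have hn : (0 : ℝ) < Fintype.card ι := by exact_mod_cast Fintype.card_pos
  rw [le_div_iff₀ (by positivity)]
  have h1 (ω : ι → α) : ind (Fintype.card ι * δ < |∑ i, g (ω i)|) * (Fintype.card ι * δ) ^ 2 ≤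
      (∑ i, g (ω i)) ^ 2 := by
    by_cases h : Fintype.card ι * δ < |∑ i, g (ω i)|
    · rw [ind_of h, one_mul, ← sq_abs (∑ i, g (ω i))]
      gcongr
    · rw [ind_of_not h, zero_mul]; positivity
  have h2 := Finset.expect_le_expect (s := Finset.univ) fun ω _ => h1 ω
  rw [expect_sq_sum g hg, ← Finset.expect_mul] at h2
  refine le_of_mul_le_mul_left ?_ hn
  linarith

theorem expect_prod {β α : Type*} [Fintype β] [DecidableEq β] [Fintype α] (f : β → α → ℝ) :
    𝔼 z : β → α, ∏ i, f i (z i) = ∏ i, 𝔼 a, f i a := by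
  simp only [Fintype.expect_eq_sum_div_card, Finset.prod_div_distrib, Finset.prod_univ_sum,
    Fintype.piFinset_univ]
  simp

theorem expect_sumElim {β γ α : Type*} [Fintype β] [Fintype γ] [Fintype α]
    [DecidableEq β] [DecidableEq γ] (f : (β ⊕ γ → α) → ℝ) :
    𝔼 a, 𝔼 b, f (Sum.elim a b) = 𝔼 u, f u := by
  rw [← Finset.expect_product' Finset.univ Finset.univ, Finset.univ_product_univ]
  exact Fintype.expect_equiv (Equiv.sumArrowEquivProdArrow β γ α).symm _ _ fun p => rfl

/-! ### Uniform random matrices. -/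

theorem exists_dotProduct_eq_one {F α : Type*} [Field F] [Fintype α]
    (U : Submodule F (α → F)) {y : α → F} (hy : y ∉ U) :
    ∃ c : α → F, (∀ u ∈ U, c ⬝ᵥ u = 0) ∧ c ⬝ᵥ y = 1 := by
  classical
  obtain ⟨φ, hφ, hU⟩ := Submodule.exists_dual_map_eq_bot_of_notMem hy inferInstance
  obtain ⟨c, rfl⟩ := (dotProductEquiv F α).surjective φ
  refine ⟨(c ⬝ᵥ y)⁻¹ • c, fun u hu => ?_, ?_⟩
  · have : dotProductEquiv F α c u ∈ U.map (dotProductEquiv F α c) := ⟨u, hu, rfl⟩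
    rw [hU, Submodule.mem_bot] at this
    rw [smul_dotProduct]
    simp only [dotProductEquiv_apply_apply] at this
    simp [this]
  · rw [smul_dotProduct]
    exact inv_mul_cancel₀ hφ

/-- The image of a vector outside `U` under a uniform matrix is uniform, independently of the
action of the matrix on `U`. -/
theorem expect_mulVec {F ρ α : Type*} [Field F] [Fintype F] [Fintype α] [Fintype ρ]
    [DecidableEq α] [DecidableEq ρ]
    (U : Submodule F (α → F)) {y : α → F} (hy : y ∉ U) (f : Matrix ρ α F → (ρ → F) → ℝ)
    (hf : ∀ Q Q' : Matrix ρ α F, (∀ u ∈ U, Q *ᵥ u = Q' *ᵥ u) → f Q = f Q') :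
    𝔼 Q, f Q (Q *ᵥ y) = 𝔼 Q, 𝔼 z, f Q z := by
  obtain ⟨c, hc, hcy⟩ := exists_dotProduct_eq_one U hy
  -- The rank-one translate `Q + z cᵀ` acts like `Q` on `U` but moves `Q y` by `z`.
  rw [expect_shift (fun z : ρ → F => Matrix.vecMulVec z c)]
  refine Finset.expect_congr rfl fun Q _ => ?_
  refine Fintype.expect_equiv (Equiv.addLeft (Q *ᵥ y)) _ _ fun z => ?_
  rw [hf (Q + Matrix.vecMulVec z c) Q fun u hu => by
    simp [Matrix.add_mulVec, Matrix.vecMulVec_mulVec, hc u hu]]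
  simp [Matrix.add_mulVec, Matrix.vecMulVec_mulVec, hcy]

/-! ### Carries of a single addition modulo `q`. -/

theorem ZMod.val_sub_add_val {q : ℕ} [NeZero q] (a b : ZMod q) :
    (a - b).val + b.val = a.val + if a.val < b.val then q else 0 := by
  obtain ⟨c, rfl⟩ : ∃ c, a = c + b := ⟨a - b, by ring⟩
  have hc := ZMod.val_lt c
  rw [add_sub_cancel_right]
  by_cases h : c.val + b.val < q
  · rw [ZMod.val_add_of_lt h, if_neg (by omega), add_zero]
  · have := ZMod.val_add_val_of_le (not_lt.1 h)
    rw [if_pos (by omega)]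
    omega

/-- The integer sum is `a.val` or `a.val + q` with `a.val < q`, so it determines both the residue
and the carry. -/
theorem ZMod.val_sub_add_val_eq_iff {q : ℕ} [NeZero q] (a b a' b' : ZMod q) :
    (((a - b).val : ℤ) + (b.val : ℤ) = ((a' - b').val : ℤ) + (b'.val : ℤ)) ↔
      a = a' ∧ decide (a.val < b.val) = decide (a'.val < b'.val) := by
  have h := ZMod.val_sub_add_val a b
  have h' := ZMod.val_sub_add_val a' b'
  have ha := ZMod.val_lt a
  have ha' := ZMod.val_lt a'
  rw [← (ZMod.val_injective q).eq_iff, decide_eq_decide]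
  split_ifs at h h' <;> omega

/-! ### Distributions of functions of uniform variables. -/

section PMF

theorem PMF.bind_map_uniformOfFintype_toReal {α β γ : Type*} [Fintype α] [Nonempty α]
    [Fintype β] [Nonempty β] (f : α → β → γ) (w : γ) :
    (((PMF.uniformOfFintype α).bind fun a => (PMF.uniformOfFintype β).map (f a)) w).toReal =
      𝔼 a, 𝔼 b, ind (f a b = w) := by
  classical
  simp only [PMF.bind_apply, PMF.map_apply, PMF.uniformOfFintype_apply, tsum_fintype,
    Fintype.expect_eq_sum_div_card]
  rw [ENNReal.toReal_sum, Finset.sum_div]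
  · refine Finset.sum_congr rfl fun a _ => ?_
    rw [ENNReal.toReal_mul, ENNReal.toReal_sum]
    · simp only [ENNReal.toReal_inv, ENNReal.toReal_natCast]
      rw [inv_mul_eq_div]
      congr 1
      rw [Finset.sum_div]
      refine Finset.sum_congr rfl fun b _ => ?_
      by_cases h : f a b = w
      · rw [if_pos h.symm, ind_of h]; simp
      · rw [if_neg (Ne.symm h), ind_of_not h]; simp
    · intro b _
      split_ifs <;> simp
  · intro a _
    refine ENNReal.mul_ne_top (by simp) ?_
    refine ENNReal.sum_ne_top.2 fun b _ => ?_
    split_ifs <;> simp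

theorem PMF.uniformOfFinset_image {α β : Type*} [Fintype α] [Nonempty α] [DecidableEq β]
    {f : α → β} (hf : Function.Injective f) (h : (Finset.univ.image f).Nonempty) :
    PMF.uniformOfFinset (Finset.univ.image f) h = (PMF.uniformOfFintype α).map f := by
  ext b
  rw [PMF.map_apply, PMF.uniformOfFinset_apply, tsum_fintype]
  simp only [PMF.uniformOfFintype_apply]
  by_cases hb : b ∈ Finset.univ.image f
  · obtain ⟨a, -, rfl⟩ := Finset.mem_image.1 hb
    rw [if_pos hb, Finset.card_image_of_injective _ hf, Finset.card_univ,
      Finset.sum_eq_single a]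
    · simp
    · intro a' _ ha'
      rw [if_neg fun h => ha' (hf h.symm)]
    · simp
  · rw [if_neg hb, Finset.sum_eq_zero]
    intro a _
    rw [if_neg]
    rintro rfl
    exact hb (Finset.mem_image_of_mem f (Finset.mem_univ a))

theorem sum_expect_ind_mul {Ω X : Type*} [Fintype Ω] (W : Ω → X) (K : Finset X) (h : X → ℝ) :
    ∑ w ∈ K, (𝔼 ω, ind (W ω = w)) * h w = 𝔼 ω, ind (W ω ∈ K) * h (W ω) := by
  classical
  simp only [Finset.expect_mul, ← Finset.expect_sum_comm]
  refine Finset.expect_congr rfl fun ω _ => ?_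
  by_cases hω : W ω ∈ K
  · rw [Finset.sum_eq_single (W ω)]
    · simp [ind, hω]
    · intro w _ hw
      rw [ind_of_not (Ne.symm hw), zero_mul]
    · exact fun h => absurd hω h
  · rw [Finset.sum_eq_zero, ind_of_not hω, zero_mul]
    intro w hw
    rw [ind_of_not, zero_mul]
    rintro rfl
    exact hω hw

end PMF

/-! ### Carry patterns and their probabilities. -/

section Carry

/-- The carries of the sum of two words with sum `s` modulo `q`, the second one being `t`. -/
def carry {q : ℕ} {ι : Type*} (s t : ι → ZMod q) : ι → Bool := fun i =>
  decide ((s i).val < (t i).val)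

theorem ind_carry_sumElim {q : ℕ} {ι κ : Type*} (s : ι → ZMod q) (s' : κ → ZMod q)
    (t u : ι → ZMod q) (t' u' : κ → ZMod q) :
    ind (carry (Sum.elim s s') (Sum.elim u u') = carry (Sum.elim s s') (Sum.elim t t')) =
      ind (carry s u = carry s t) * ind (carry s' u' = carry s' t') := by
  rw [← ind_and]
  congr 1
  simp [carry, funext_iff]

variable {q : ℕ} [NeZero q] {ι : Type*}

/-- The conditional probability of a carry, given the sum modulo `q`. -/
def carryProb (a : ZMod q) (b : Bool) : ℝ := 𝔼 u : ZMod q, ind (decide (a.val < u.val) = b)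

/-- The conditional probability of a word of carries, given the sum modulo `q`. -/
def carryWeight [Fintype ι] (s : ι → ZMod q) (c : ι → Bool) : ℝ := ∏ i, carryProb (s i) (c i)

theorem carryProb_nonneg (a : ZMod q) (b : Bool) : 0 ≤ carryProb a b :=
  Finset.expect_nonneg fun _ _ => ind_nonneg _

theorem carryProb_le_one (a : ZMod q) (b : Bool) : carryProb a b ≤ 1 :=
  Finset.expect_le Finset.univ_nonempty fun _ _ => ind_le_one _

theorem carryProb_decide_pos (a u : ZMod q) : 0 < carryProb a (decide (a.val < u.val)) :=
  Finset.expect_pos' (fun _ _ => ind_nonneg _) ⟨u, Finset.mem_univ u, by rw [ind_of rfl]; simp⟩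

variable [Fintype ι]

theorem carryWeight_nonneg (s : ι → ZMod q) (c : ι → Bool) : 0 ≤ carryWeight s c :=
  Finset.prod_nonneg fun _ _ => carryProb_nonneg _ _

theorem carryWeight_sumElim {κ : Type*} [Fintype κ] (s : ι → ZMod q) (s' : κ → ZMod q)
    (t : ι → ZMod q) (t' : κ → ZMod q) :
    carryWeight (Sum.elim s s') (carry (Sum.elim s s') (Sum.elim t t')) =
      carryWeight s (carry s t) * carryWeight s' (carry s' t') := by
  simp [carryWeight, carry, Fintype.prod_sum_type]
  rfl

variable [DecidableEq ι]

theorem expect_ind_carry (s : ι → ZMod q) (c : ι → Bool) :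
    𝔼 t, ind (carry s t = c) = carryWeight s c := by
  simp only [funext_iff, ind_forall, carry]
  rw [expect_prod fun i (a : ZMod q) => ind (decide ((s i).val < a.val) = c i)]
  rfl

theorem sum_carryWeight_le (s : ι → ZMod q) (C : Finset (ι → Bool)) :
    ∑ c ∈ C, carryWeight s c ≤ 1 := by
  simp only [← expect_ind_carry]
  have := sum_expect_ind_mul (carry s) C fun _ => 1
  simp only [mul_one] at this
  rw [this]
  exact Finset.expect_le Finset.univ_nonempty fun _ _ => ind_le_one _

end Carry

/-! ### `D(q)` as conditional entropy of a carry, and typical pairs. -/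

section Entropy

theorem entropy_eq_expect {Ω : Type*} [Fintype Ω] (p : PMF ℤ) (W : Ω → ℤ)
    (hp : ∀ w, (p w).toReal = 𝔼 ω, ind (W ω = w)) :
    entropy p = 𝔼 ω, -Real.logb 2 (p (W ω)).toReal := by
  classical
  have hsupp : (Function.support fun a : ℤ => -((p a).toReal * Real.logb 2 (p a).toReal)) ⊆
      (Finset.univ.image W : Finset ℤ) := by
    intro w hw
    by_contra hW
    refine hw ?_
    have : (p w).toReal = 0 := by
      rw [hp, Finset.expect_eq_zero]
      intro ω _
      refine ind_of_not fun h => hW ?_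
      rw [← h]
      exact Finset.mem_coe.2 (Finset.mem_image_of_mem W (Finset.mem_univ ω))
    simp [this]
  rw [entropy, finsum_eq_sum_of_support_subset _ hsupp]
  have := sum_expect_ind_mul W (Finset.univ.image W) fun w => -Real.logb 2 (p w).toReal
  simp only [← hp, mul_neg] at this
  rw [this]
  refine Finset.expect_congr rfl fun ω _ => ?_
  rw [ind_of (Finset.mem_image_of_mem W (Finset.mem_univ ω)), one_mul]

variable (q : ℕ) [NeZero q]

theorem distW_toReal (w : ℤ) : (distW q w).toReal =
    𝔼 p : ZMod q × ZMod q, ind (((p.1 - p.2).val : ℤ) + (p.2.val : ℤ) = w) := by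
  rw [distW, PMF.bind_map_uniformOfFintype_toReal, ← Finset.univ_product_univ,
    Finset.expect_product, Finset.expect_comm]
  conv_rhs => rw [Finset.expect_comm]
  refine Finset.expect_congr rfl fun b _ => ?_
  exact Fintype.expect_equiv (Equiv.addRight b) _ _ fun a => by simp

/-- Chain rule for `W`: the residue is uniform, contributing `1 / q`, and the carry has its
conditional probability given the residue. -/
theorem distW_val_sub_add_val (s t : ZMod q) :
    (distW q (((s - t).val : ℤ) + (t.val : ℤ))).toReal =
      carryProb s (decide (s.val < t.val)) / q := by
  rw [distW_toReal, ← Finset.univ_product_univ, Finset.expect_product]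
  simp only [ZMod.val_sub_add_val_eq_iff, ind_and, ← Finset.mul_expect]
  rw [Fintype.expect_eq_sum_div_card, Finset.sum_eq_single s]
  · rw [ind_of rfl, one_mul, ZMod.card, carryProb]
  · intro a _ ha
    rw [ind_of_not ha, zero_mul]
  · simp

/-- The conditional self-information of the carry, given the sum modulo `q`. -/
def carryInfo (p : ZMod q × ZMod q) : ℝ :=
  -Real.logb 2 (carryProb p.1 (decide (p.1.val < p.2.val)))

/-- Taking `-log` in the chain rule splits the entropy of `W` into `log q` and the mean information
of the carry. -/
theorem expect_carryInfo : 𝔼 p, carryInfo q p = capD q := by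
  rw [capD, entropy_eq_expect _ _ (distW_toReal q)]
  have hq : (q : ℝ) ≠ 0 := Nat.cast_ne_zero.2 (NeZero.ne q)
  rw [eq_sub_iff_add_eq, ← Fintype.expect_const (ι := ZMod q × ZMod q) (Real.logb 2 q),
    ← Finset.expect_add_distrib]
  refine Finset.expect_congr rfl fun p _ => ?_
  rw [distW_val_sub_add_val, Real.logb_div (carryProb_decide_pos _ _).ne' hq, carryInfo]
  ring

theorem capD_nonneg : 0 ≤ capD q := by
  rw [← expect_carryInfo]
  refine Finset.expect_nonneg fun p _ => neg_nonneg.2 ?_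
  exact Real.logb_nonpos (by norm_num) (carryProb_nonneg _ _) (carryProb_le_one _ _)

variable {q} {ι : Type*} [Fintype ι]

/-- Typicality of a pair of words: the conditional probability of the carries is
`2 ^ (-n (D ± δ))`. -/
def IsTypical (δ : ℝ) (s t : ι → ZMod q) : Prop :=
  (2 : ℝ) ^ (-((Fintype.card ι : ℝ) * (capD q + δ))) ≤ carryWeight s (carry s t) ∧
    carryWeight s (carry s t) ≤ (2 : ℝ) ^ (-((Fintype.card ι : ℝ) * (capD q - δ)))

/-- The weight is a product over coordinates, so its negative logarithm is a sum of
self-informations, to which the weak law applies. -/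
theorem isTypical_of_abs_le {δ : ℝ} {s t : ι → ZMod q}
    (h : |∑ i, (carryInfo q (s i, t i) - capD q)| ≤ Fintype.card ι * δ) : IsTypical δ s t := by
  have hw : carryWeight s (carry s t) = (2 : ℝ) ^ (-∑ i, carryInfo q (s i, t i)) := by
    rw [← Finset.sum_neg_distrib, Real.rpow_sum_of_pos (by norm_num)]
    refine Finset.prod_congr rfl fun i _ => ?_
    rw [carryInfo, neg_neg, Real.rpow_logb (by norm_num) (by norm_num) (carryProb_decide_pos _ _)]
    rfl
  rw [Finset.sum_sub_distrib, Finset.sum_const, nsmul_eq_mul, Finset.card_univ, abs_le] at h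
  rw [IsTypical, hw]
  constructor <;> refine Real.rpow_le_rpow_of_exponent_le (by norm_num) ?_ <;> linarith

variable [DecidableEq ι]

theorem expect_ind_not_isTypical_le [Nonempty ι] {δ : ℝ} (hδ : 0 < δ) :
    𝔼 s : ι → ZMod q, 𝔼 t, ind (¬IsTypical δ s t) ≤
      (𝔼 p, (carryInfo q p - capD q) ^ 2) / (Fintype.card ι * δ ^ 2) := by
  refine le_trans ?_ (expect_ind_deviation_le (ι := ι) (fun p => carryInfo q p - capD q) ?_ hδ)
  · rw [← Finset.expect_product' Finset.univ Finset.univ, Finset.univ_product_univ,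
      ← Fintype.expect_equiv (Equiv.arrowProdEquivProdArrow ι _ _) _ _ fun p => rfl]
    refine Finset.expect_le_expect fun ω _ => ind_mono fun h => ?_
    by_contra h'
    exact h (isTypical_of_abs_le (not_lt.1 h'))
  · rw [Finset.expect_sub_distrib, Fintype.expect_const, expect_carryInfo, sub_self]

end Entropy

/-! ### A counting bound for classes. -/

/-- Few points lie in classes of equal images of small cardinality but of large weight. -/
theorem sum_ind_small_class_le {β γ : Type*} [Fintype β] [DecidableEq γ] (c : β → γ) (W : γ → ℝ)
    (hW : ∀ x, 0 ≤ W x) (hsum : ∑ x ∈ Finset.univ.image c, W x ≤ 1) {τ₀ τ : ℝ} (h₀ : 0 < τ₀)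
    (hτ : 0 ≤ τ) :
    ∑ b, ind (τ₀ ≤ W (c b) ∧ ∑ b', ind (c b' = c b) < τ) ≤ τ / τ₀ := by
  have hpos (b : β) : 0 < ∑ b', ind (c b' = c b) :=
    Finset.sum_pos' (fun _ _ => ind_nonneg _) ⟨b, Finset.mem_univ b, by rw [ind_of rfl]; simp⟩
  -- Each bad point is charged `(τ / τ₀) * W / (class size)`, which is at least one for it. Summed
  -- over a class, the charges give `(τ / τ₀) * W`.
  calc ∑ b, ind (τ₀ ≤ W (c b) ∧ ∑ b', ind (c b' = c b) < τ)
      ≤ ∑ b, τ / τ₀ * (W (c b) / ∑ b', ind (c b' = c b)) := by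
        refine Finset.sum_le_sum fun b _ => ?_
        by_cases h : τ₀ ≤ W (c b) ∧ ∑ b', ind (c b' = c b) < τ
        · rw [ind_of h, div_mul_div_comm, le_div_iff₀ (mul_pos h₀ (hpos b)), one_mul, mul_comm]
          exact mul_le_mul h.2.le h.1 h₀.le hτ
        · rw [ind_of_not h]
          have := hpos b
          have := hW (c b)
          positivity
    _ = τ / τ₀ * ∑ x ∈ Finset.univ.image c, W x := by
        rw [← Finset.mul_sum, Finset.sum_comp (fun x => W x / ∑ b', ind (c b' = x))]
        congr 1
        refine Finset.sum_congr rfl fun x hx => ?_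
        obtain ⟨b, -, rfl⟩ := Finset.mem_image.1 hx
        rw [nsmul_eq_mul, ← sum_ind, mul_div_cancel₀]
        exact (hpos b).ne'
    _ ≤ τ / τ₀ := mul_le_of_le_one_right (div_nonneg hτ h₀.le) hsum

/-! ### Collision numbers in the random code ensemble. -/

section Ensemble

variable {q : ℕ} {κ μ ρ : Type*} [Fintype κ] [Fintype μ]

/-- The message of the codeword of the subcode with parameter `v`. -/
def subMsg (H : Matrix μ κ (ZMod q)) (v : κ → ZMod q) : κ ⊕ μ → ZMod q := Sum.elim v (H *ᵥ v)

/-- The systematic codeword of a message. -/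
def codeword (Q : Matrix ρ (κ ⊕ μ) (ZMod q)) (m : κ ⊕ μ → ZMod q) : (κ ⊕ μ) ⊕ ρ → ZMod q :=
  Sum.elim m (Q *ᵥ m)

/-- The number of codewords of the subcode with the same carries as the one with parameter `v`,
for the sum `s`. -/
def collisions (Q : Matrix ρ (κ ⊕ μ) (ZMod q)) (H : Matrix μ κ (ZMod q))
    [NeZero q] [DecidableEq κ] (s : (κ ⊕ μ) ⊕ ρ → ZMod q) (v : κ → ZMod q) : ℝ :=
  ∑ u : κ → ZMod q, ind (carry s (codeword Q (subMsg H u)) = carry s (codeword Q (subMsg H v)))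

omit [Fintype μ] in
theorem subMsg_injective (H : Matrix μ κ (ZMod q)) : Function.Injective (subMsg H) :=
  fun _ _ h => funext fun i => congrFun h (Sum.inl i)

omit [Fintype μ] in
theorem subMsg_smul (H : Matrix μ κ (ZMod q)) (a : ZMod q) (v : κ → ZMod q) :
    subMsg H (a • v) = a • subMsg H v := by
  ext (i | i) <;> simp [subMsg, Matrix.mulVec_smul]

variable [Fact q.Prime] [Fintype ρ] [DecidableEq κ] [DecidableEq μ] [DecidableEq ρ]

omit [DecidableEq μ] [Fintype ρ] [DecidableEq ρ] in
theorem one_le_collisions (Q : Matrix ρ (κ ⊕ μ) (ZMod q)) (H : Matrix μ κ (ZMod q))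
    (s : (κ ⊕ μ) ⊕ ρ → ZMod q) (v : κ → ZMod q) : 1 ≤ collisions Q H s v := by
  refine le_trans (ind_of rfl).ge (Finset.single_le_sum (f := fun u : κ → ZMod q =>
    ind (carry s (codeword Q (subMsg H u)) = carry s (codeword Q (subMsg H v))))
    (fun _ _ => ind_nonneg _) (Finset.mem_univ v))

omit [DecidableEq μ] [Fintype ρ] [DecidableEq ρ] in
theorem collisions_le (Q : Matrix ρ (κ ⊕ μ) (ZMod q)) (H : Matrix μ κ (ZMod q))
    (s : (κ ⊕ μ) ⊕ ρ → ZMod q) (v : κ → ZMod q) :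
    collisions Q H s v ≤ (q : ℝ) ^ Fintype.card κ := by
  refine (Finset.sum_le_card_nsmul _ _ 1 fun _ _ => ind_le_one _).trans ?_
  simp [Finset.card_univ, ZMod.card]

theorem expect_ind_mem_span_singleton_le {α : Type*} [Fintype α] [DecidableEq α]
    (x : α → ZMod q) :
    𝔼 m : α → ZMod q, ind (m ∈ Submodule.span (ZMod q) {x}) ≤
      (q : ℝ) / (q : ℝ) ^ Fintype.card α := by
  classical
  rw [expect_ind, Fintype.card_fun, ZMod.card, Nat.cast_pow]
  gcongr
  calc (Finset.univ.filter fun m => m ∈ Submodule.span (ZMod q) {x}).card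
      ≤ (Finset.univ.image fun a : ZMod q => a • x).card := by
        refine Finset.card_le_card fun m hm => ?_
        obtain ⟨a, rfl⟩ := Submodule.mem_span_singleton.1 (Finset.mem_filter.1 hm).2
        exact Finset.mem_image_of_mem _ (Finset.mem_univ a)
    _ ≤ q := Finset.card_image_le.trans (by simp [ZMod.card])

theorem sum_ind_mem_span_pair_le {β α : Type*} [Fintype β] {f : β → α → ZMod q}
    (hf : Function.Injective f) (m x : α → ZMod q) :
    ∑ u, ind (f u ∈ Submodule.span (ZMod q) {m, x}) ≤ (q : ℝ) ^ 2 := by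
  classical
  rw [sum_ind, ← Nat.cast_pow, Nat.cast_le]
  calc (Finset.univ.filter fun u => f u ∈ Submodule.span (ZMod q) {m, x}).card
      = ((Finset.univ.filter fun u => f u ∈ Submodule.span (ZMod q) {m, x}).image f).card :=
        (Finset.card_image_of_injective _ hf).symm
    _ ≤ (Finset.univ.image fun a : ZMod q × ZMod q => a.1 • m + a.2 • x).card := by
        refine Finset.card_le_card fun y hy => ?_
        obtain ⟨u, hu, rfl⟩ := Finset.mem_image.1 hy
        obtain ⟨a, b, h⟩ := Submodule.mem_span_pair.1 (Finset.mem_filter.1 hu).2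
        exact Finset.mem_image.2 ⟨(a, b), Finset.mem_univ _, h⟩
    _ ≤ q ^ 2 := Finset.card_image_le.trans (by simp [ZMod.card, sq])

theorem expect_ind_eq_zero {α : Type*} [Fintype α] [DecidableEq α] :
    𝔼 v : α → ZMod q, ind (v = 0) = 1 / (q : ℝ) ^ Fintype.card α := by
  rw [expect_ind, Fintype.card_fun, ZMod.card, Nat.cast_pow, Finset.filter_eq']
  simp

/-- The pair of words of the ensemble is nearly uniformly distributed. -/
theorem expect_ensemble_le (d : (κ ⊕ μ) ⊕ ρ → ZMod q)
    (f : ((κ ⊕ μ) ⊕ ρ → ZMod q) → ((κ ⊕ μ) ⊕ ρ → ZMod q) → ℝ)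
    (hf₀ : ∀ s t, 0 ≤ f s t) (hf₁ : ∀ s t, f s t ≤ 1) :
    𝔼 m, 𝔼 v, 𝔼 H : Matrix μ κ (ZMod q), 𝔼 Q : Matrix ρ (κ ⊕ μ) (ZMod q),
        f (codeword Q m + d) (codeword Q (subMsg H v)) ≤
      (𝔼 s, 𝔼 t, f s t) + (q : ℝ) / (q : ℝ) ^ Fintype.card (κ ⊕ μ) +
        2 / (q : ℝ) ^ Fintype.card κ := by
  -- With `H` fixed, `Q` maps linearly independent messages to independent uniform words.
  -- Independence fails only when `v = 0` or `m` is a multiple of `subMsg H v`; there `f ≤ 1` is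
  -- paid for by an indicator.
  have step₁ (m v) (H : Matrix μ κ (ZMod q)) : 𝔼 Q : Matrix ρ (κ ⊕ μ) (ZMod q),
      f (codeword Q m + d) (codeword Q (subMsg H v)) ≤
        (𝔼 a, 𝔼 b, f (Sum.elim m a + d) (Sum.elim (subMsg H v) b)) +
          ind (m ∈ Submodule.span (ZMod q) {subMsg H v}) + ind (v = 0) := by
    have h0 : 0 ≤ 𝔼 a, 𝔼 b, f (Sum.elim m a + d) (Sum.elim (subMsg H v) b) :=
      Finset.expect_nonneg fun _ _ => Finset.expect_nonneg fun _ _ => hf₀ _ _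
    have h1 : 𝔼 Q : Matrix ρ (κ ⊕ μ) (ZMod q),
        f (codeword Q m + d) (codeword Q (subMsg H v)) ≤ 1 :=
      Finset.expect_le Finset.univ_nonempty fun _ _ => hf₁ _ _
    by_cases hm : m ∈ Submodule.span (ZMod q) {subMsg H v}
    · rw [ind_of hm]
      linarith [ind_nonneg (v = 0)]
    by_cases hv : v = 0
    · rw [ind_of hv]
      linarith [ind_nonneg (m ∈ Submodule.span (ZMod q) {subMsg H v})]
    rw [ind_of_not hm, ind_of_not hv, add_zero, add_zero]
    refine le_of_eq ?_
    have hx : subMsg H v ∉ (⊥ : Submodule (ZMod q) (κ ⊕ μ → ZMod q)) := fun h => hv <| by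
      have h' := (Submodule.mem_bot _).1 h
      exact funext fun i => congrFun h' (Sum.inl i)
    have e₁ := expect_mulVec (ρ := ρ) _ hm
      (fun Q z => f (Sum.elim m z + d) (codeword Q (subMsg H v))) (fun Q Q' h => by
        have := h _ (Submodule.mem_span_singleton_self _)
        simp only [codeword, this])
    refine e₁.trans ?_
    rw [Finset.expect_comm]
    refine Finset.expect_congr rfl fun z _ => ?_
    have e₂ := expect_mulVec (ρ := ρ) _ hx
      (fun _ b => f (Sum.elim m z + d) (Sum.elim (subMsg H v) b)) (fun _ _ _ => rfl)
    rw [Fintype.expect_const] at e₂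
    exact e₂
  -- For `v ≠ 0` the block `H v` is uniform, which completes `v` to a uniform message.
  have step₂ (m) (v : κ → ZMod q) : 𝔼 H : Matrix μ κ (ZMod q),
      𝔼 a, 𝔼 b, f (Sum.elim m a + d) (Sum.elim (subMsg H v) b) ≤
        (𝔼 e, 𝔼 a, 𝔼 b, f (Sum.elim m a + d) (Sum.elim (Sum.elim v e) b)) + ind (v = 0) := by
    by_cases hv : v = 0
    · rw [ind_of hv]
      have h0 : 0 ≤ 𝔼 e, 𝔼 a, 𝔼 b, f (Sum.elim m a + d) (Sum.elim (Sum.elim v e) b) :=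
        Finset.expect_nonneg fun _ _ => Finset.expect_nonneg fun _ _ =>
          Finset.expect_nonneg fun _ _ => hf₀ _ _
      have h1 : 𝔼 H : Matrix μ κ (ZMod q),
          𝔼 a, 𝔼 b, f (Sum.elim m a + d) (Sum.elim (subMsg H v) b) ≤ 1 :=
        Finset.expect_le Finset.univ_nonempty fun _ _ => Finset.expect_le Finset.univ_nonempty
          fun _ _ => Finset.expect_le Finset.univ_nonempty fun _ _ => hf₁ _ _
      linarith
    · rw [ind_of_not hv, add_zero]
      refine le_of_eq ?_
      have hv' : v ∉ (⊥ : Submodule (ZMod q) (κ → ZMod q)) := hv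
      have e := expect_mulVec (ρ := μ) _ hv'
        (fun _ e => 𝔼 a, 𝔼 b, f (Sum.elim m a + d) (Sum.elim (Sum.elim v e) b))
        (fun _ _ _ => rfl)
      rw [Fintype.expect_const] at e
      exact e
  have main : 𝔼 m, 𝔼 v : κ → ZMod q, 𝔼 e : μ → ZMod q, 𝔼 a, 𝔼 b,
      f (Sum.elim m a + d) (Sum.elim (Sum.elim v e) b) = 𝔼 s, 𝔼 t, f s t := by
    have h (m : κ ⊕ μ → ZMod q) : 𝔼 v : κ → ZMod q, 𝔼 e : μ → ZMod q, 𝔼 a, 𝔼 b,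
        f (Sum.elim m a + d) (Sum.elim (Sum.elim v e) b) =
          𝔼 a, 𝔼 t, f (Sum.elim m a + d) t := by
      rw [expect_sumElim fun x => 𝔼 a, 𝔼 b, f (Sum.elim m a + d) (Sum.elim x b),
        Finset.expect_comm]
      exact Finset.expect_congr rfl fun a _ => expect_sumElim (f (Sum.elim m a + d))
    simp only [h]
    rw [expect_sumElim fun s => 𝔼 t, f (s + d) t]
    exact Fintype.expect_equiv (Equiv.addRight d) _ _ fun s => rfl
  have hspan : 𝔼 m, 𝔼 v, 𝔼 H : Matrix μ κ (ZMod q),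
      ind (m ∈ Submodule.span (ZMod q) {subMsg H v}) ≤
        (q : ℝ) / (q : ℝ) ^ Fintype.card (κ ⊕ μ) := by
    rw [Finset.expect_comm]
    refine Finset.expect_le Finset.univ_nonempty fun v _ => ?_
    rw [Finset.expect_comm]
    exact Finset.expect_le Finset.univ_nonempty fun H _ => expect_ind_mem_span_singleton_le _
  calc _ ≤ 𝔼 m, 𝔼 v, 𝔼 H : Matrix μ κ (ZMod q),
        ((𝔼 a, 𝔼 b, f (Sum.elim m a + d) (Sum.elim (subMsg H v) b)) +
          ind (m ∈ Submodule.span (ZMod q) {subMsg H v}) + ind (v = 0)) :=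
        Finset.expect_le_expect fun m _ => Finset.expect_le_expect fun v _ =>
          Finset.expect_le_expect fun H _ => step₁ m v H
    _ ≤ 𝔼 m, 𝔼 v, ((𝔼 e, 𝔼 a, 𝔼 b, f (Sum.elim m a + d) (Sum.elim (Sum.elim v e) b)) +
          ind (v = 0) + (𝔼 H : Matrix μ κ (ZMod q),
            ind (m ∈ Submodule.span (ZMod q) {subMsg H v})) + ind (v = 0)) := by
        refine Finset.expect_le_expect fun m _ => Finset.expect_le_expect fun v _ => ?_
        rw [Finset.expect_add_distrib, Finset.expect_add_distrib, Fintype.expect_const]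
        gcongr
        exact step₂ m v
    _ ≤ _ := by
        simp only [Finset.expect_add_distrib]
        rw [main, expect_ind_eq_zero, Fintype.expect_const]
        calc _ ≤ (𝔼 s, 𝔼 t, f s t) + 1 / (q : ℝ) ^ Fintype.card κ +
              (q : ℝ) / (q : ℝ) ^ Fintype.card (κ ⊕ μ) + 1 / (q : ℝ) ^ Fintype.card κ := by
              gcongr
          _ = _ := by ring

/-- Apart from the codewords whose message depends linearly on those of the two given words,
the codewords of the subcode collide with the probability of a uniform word. -/
theorem expect_sum_ind_carry_le (d : (κ ⊕ μ) ⊕ ρ → ZMod q)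
    (g : ((κ ⊕ μ) ⊕ ρ → ZMod q) → ((κ ⊕ μ) ⊕ ρ → ZMod q) → ℝ) (hg : ∀ s t, 0 ≤ g s t)
    (m : κ ⊕ μ → ZMod q) (v : κ → ZMod q) :
    𝔼 H : Matrix μ κ (ZMod q), 𝔼 Q : Matrix ρ (κ ⊕ μ) (ZMod q), ∑ u : κ → ZMod q,
        ind (subMsg H u ∉ Submodule.span (ZMod q) {m, subMsg H v}) *
          (g (codeword Q m + d) (codeword Q (subMsg H v)) *
            ind (carry (codeword Q m + d) (codeword Q (subMsg H u)) =
              carry (codeword Q m + d) (codeword Q (subMsg H v)))) ≤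
      (q : ℝ) ^ Fintype.card κ * 𝔼 H : Matrix μ κ (ZMod q), 𝔼 Q : Matrix ρ (κ ⊕ μ) (ZMod q),
        g (codeword Q m + d) (codeword Q (subMsg H v)) *
          carryWeight (codeword Q m + d) (carry (codeword Q m + d) (codeword Q (subMsg H v))) := by
  -- The three blocks of a codeword have separate sources of randomness: the parity block from `Q`,
  -- the `μ` block from `H`, and the `κ` block from the sum over `u`. The systematic part `(s₁, s₂)`
  -- of `s` depends on neither matrix.
  obtain ⟨d, d₃, rfl⟩ : ∃ a b, d = Sum.elim a b := ⟨_, _, (Sum.elim_comp_inl_inr d).symm⟩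
  obtain ⟨s₁, s₂, hs⟩ : ∃ a b, m + d = Sum.elim a b :=
    ⟨_, _, (Sum.elim_comp_inl_inr (m + d)).symm⟩
  have hsplit (Q : Matrix ρ (κ ⊕ μ) (ZMod q)) : codeword Q m + Sum.elim d d₃ =
      Sum.elim (Sum.elim s₁ s₂) (Q *ᵥ m + d₃) := by
    rw [← hs, codeword]
    ext (i | i) <;> rfl
  simp only [hsplit]
  set s : Matrix ρ (κ ⊕ μ) (ZMod q) → (κ ⊕ μ) ⊕ ρ → ZMod q :=
    fun Q => Sum.elim (Sum.elim s₁ s₂) (Q *ᵥ m + d₃) with hsdef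
  -- Resampling `Q` on `subMsg H u` leaves `s` and the codeword of `v` unchanged, since these depend
  -- only on the action of `Q` on the span.
  have step₁ (u) (H : Matrix μ κ (ZMod q)) : 𝔼 Q : Matrix ρ (κ ⊕ μ) (ZMod q),
      ind (subMsg H u ∉ Submodule.span (ZMod q) {m, subMsg H v}) *
        (g (s Q) (codeword Q (subMsg H v)) *
          ind (carry (s Q) (codeword Q (subMsg H u)) = carry (s Q) (codeword Q (subMsg H v)))) ≤
      𝔼 Q : Matrix ρ (κ ⊕ μ) (ZMod q), g (s Q) (codeword Q (subMsg H v)) *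
        (ind (carry s₁ u = carry s₁ v) * ind (carry s₂ (H *ᵥ u) = carry s₂ (H *ᵥ v)) *
          carryWeight (Q *ᵥ m + d₃) (carry (Q *ᵥ m + d₃) (Q *ᵥ subMsg H v))) := by
    by_cases hu : subMsg H u ∈ Submodule.span (ZMod q) {m, subMsg H v}
    · rw [ind_of_not (not_not.2 hu)]
      simp only [zero_mul, Finset.expect_const_zero]
      exact Finset.expect_nonneg fun Q _ => mul_nonneg (hg _ _)
        (mul_nonneg (mul_nonneg (ind_nonneg _) (ind_nonneg _)) (carryWeight_nonneg _ _))
    rw [ind_of hu]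
    refine le_of_eq ?_
    have e := expect_mulVec (ρ := ρ) _ hu (fun Q z => g (s Q) (codeword Q (subMsg H v)) *
        (ind (carry s₁ u = carry s₁ v) * ind (carry s₂ (H *ᵥ u) = carry s₂ (H *ᵥ v)) *
          ind (carry (Q *ᵥ m + d₃) z = carry (Q *ᵥ m + d₃) (Q *ᵥ subMsg H v)))) (by
        intro Q Q' h
        have h₁ := h m (Submodule.subset_span (by simp))
        have h₂ := h (subMsg H v) (Submodule.subset_span (by simp))
        simp only [hsdef, codeword, h₁, h₂])
    simp only [← Finset.mul_expect, expect_ind_carry] at e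
    rw [← e]
    refine Finset.expect_congr rfl fun Q _ => ?_
    rw [one_mul, ← ind_carry_sumElim, ← ind_carry_sumElim]
    rfl
  have step₂ (u) : 𝔼 H : Matrix μ κ (ZMod q), 𝔼 Q : Matrix ρ (κ ⊕ μ) (ZMod q),
      ind (subMsg H u ∉ Submodule.span (ZMod q) {m, subMsg H v}) *
        (g (s Q) (codeword Q (subMsg H v)) *
          ind (carry (s Q) (codeword Q (subMsg H u)) = carry (s Q) (codeword Q (subMsg H v)))) ≤
      ind (carry s₁ u = carry s₁ v) *
        𝔼 H : Matrix μ κ (ZMod q), 𝔼 Q : Matrix ρ (κ ⊕ μ) (ZMod q),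
        g (s Q) (codeword Q (subMsg H v)) * (carryWeight s₂ (carry s₂ (H *ᵥ v)) *
          carryWeight (Q *ᵥ m + d₃) (carry (Q *ᵥ m + d₃) (Q *ᵥ subMsg H v))) := by
    -- If `u` is a multiple of `v`, then `subMsg H u` is a multiple of `subMsg H v` for every `H`
    -- and the term is excluded. Otherwise `H u` can be resampled with `H v`, hence `subMsg H v`,
    -- fixed.
    by_cases hu : u ∈ Submodule.span (ZMod q) {v}
    · obtain ⟨a, rfl⟩ := Submodule.mem_span_singleton.1 hu
      have hmem (H : Matrix μ κ (ZMod q)) :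
          subMsg H (a • v) ∈ Submodule.span (ZMod q) {m, subMsg H v} := by
        rw [subMsg_smul]
        exact Submodule.smul_mem _ _ (Submodule.subset_span (by simp))
      simp only [ind_of_not (not_not.2 (hmem _)), zero_mul, Finset.expect_const_zero]
      exact mul_nonneg (ind_nonneg _) <| Finset.expect_nonneg fun H _ =>
        Finset.expect_nonneg fun Q _ => mul_nonneg (hg _ _)
          (mul_nonneg (carryWeight_nonneg _ _) (carryWeight_nonneg _ _))
    refine (Finset.expect_le_expect fun H _ => step₁ u H).trans (le_of_eq ?_)
    rw [Finset.expect_comm, Finset.expect_comm (t := (Finset.univ :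
      Finset (Matrix ρ (κ ⊕ μ) (ZMod q)))), Finset.mul_expect]
    refine Finset.expect_congr rfl fun Q _ => ?_
    have e := expect_mulVec (ρ := μ) _ hu (fun H z => g (s Q) (codeword Q (subMsg H v)) *
        carryWeight (Q *ᵥ m + d₃) (carry (Q *ᵥ m + d₃) (Q *ᵥ subMsg H v)) *
        ind (carry s₂ z = carry s₂ (H *ᵥ v))) (by
        intro H H' h
        have h₁ := h v (Submodule.mem_span_singleton_self _)
        simp only [subMsg, h₁])
    simp only [← Finset.mul_expect, expect_ind_carry] at e
    calc _ = ind (carry s₁ u = carry s₁ v) * 𝔼 H : Matrix μ κ (ZMod q),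
          g (s Q) (codeword Q (subMsg H v)) *
            carryWeight (Q *ᵥ m + d₃) (carry (Q *ᵥ m + d₃) (Q *ᵥ subMsg H v)) *
            ind (carry s₂ (H *ᵥ u) = carry s₂ (H *ᵥ v)) := by
          rw [Finset.mul_expect]
          exact Finset.expect_congr rfl fun H _ => by ring
      _ = _ := by
          rw [e]
          congr 1
          exact Finset.expect_congr rfl fun H _ => by ring
  -- No randomness is needed in this block: `u` runs over all of `𝔽_q^κ`, so the sum is an exact
  -- count.
  have hsum : ∑ u : κ → ZMod q, ind (carry s₁ u = carry s₁ v) =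
      (q : ℝ) ^ Fintype.card κ * carryWeight s₁ (carry s₁ v) := by
    have hq : (q : ℝ) ≠ 0 := Nat.cast_ne_zero.2 (NeZero.ne q)
    rw [← expect_ind_carry, Fintype.expect_eq_sum_div_card, Fintype.card_fun, ZMod.card,
      Nat.cast_pow, mul_div_cancel₀ _ (pow_ne_zero _ hq)]
  simp only [Finset.expect_sum_comm]
  refine (Finset.sum_le_sum fun u _ => step₂ u).trans (le_of_eq ?_)
  rw [← Finset.sum_mul, hsum, mul_assoc, Finset.mul_expect]
  congr 1
  refine Finset.expect_congr rfl fun H _ => ?_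
  rw [Finset.mul_expect]
  refine Finset.expect_congr rfl fun Q _ => ?_
  rw [hsdef]
  simp only [codeword, subMsg, carryWeight_sumElim]
  ring

/-- The collision number of a typical pair of words is `q ^ |κ| * 2 ^ (-n (D ± 2 δ))`, or it is
bounded. -/
theorem expect_ind_not_collisions_le [Nonempty ((κ ⊕ μ) ⊕ ρ)] (d : (κ ⊕ μ) ⊕ ρ → ZMod q)
    {δ : ℝ} (hδ : 0 < δ) {n : ℕ} (hn : Fintype.card ((κ ⊕ μ) ⊕ ρ) = n) :
    𝔼 m, 𝔼 v, 𝔼 H : Matrix μ κ (ZMod q), 𝔼 Q : Matrix ρ (κ ⊕ μ) (ZMod q),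
      ind (¬((q : ℝ) ^ Fintype.card κ * (2 : ℝ) ^ (-((n : ℝ) * (capD q + 2 * δ))) ≤
          collisions Q H (codeword Q m + d) v ∧
        collisions Q H (codeword Q m + d) v ≤
          (q : ℝ) ^ 2 + (q : ℝ) ^ Fintype.card κ * (2 : ℝ) ^ (-((n : ℝ) * (capD q - 2 * δ))))) ≤
      (𝔼 p, (carryInfo q p - capD q) ^ 2) / (n * δ ^ 2) +
        (q : ℝ) / (q : ℝ) ^ Fintype.card (κ ⊕ μ) + 2 / (q : ℝ) ^ Fintype.card κ +
        2 * (2 : ℝ) ^ (-((n : ℝ) * δ)) := by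
  classical
  have hq : (0 : ℝ) < q := Nat.cast_pos.2 (NeZero.pos q)
  -- Typicality holds with `δ`, the thresholds use `2 * δ`; the gap yields the factor `2 ^ (-n δ)`
  -- in both Markov-type bounds below.
  set τ₁ := (q : ℝ) ^ Fintype.card κ * (2 : ℝ) ^ (-((n : ℝ) * (capD q + 2 * δ))) with hτ₁
  set τ₂ := (q : ℝ) ^ Fintype.card κ * (2 : ℝ) ^ (-((n : ℝ) * (capD q - 2 * δ))) with hτ₂
  set τ₀ := (2 : ℝ) ^ (-((n : ℝ) * (capD q + δ))) with hτ₀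
  have hτ₀pos : 0 < τ₀ := by positivity
  have hτ₁pos : 0 < τ₁ := by positivity
  have hτ₂pos : 0 < τ₂ := by positivity
  -- `A` records atypical pairs, `B` typical weight with too few collisions, and `C` counts
  -- collisions from messages independent of the two given ones.
  let A (m v) (H : Matrix μ κ (ZMod q)) (Q : Matrix ρ (κ ⊕ μ) (ZMod q)) : ℝ :=
    ind (¬IsTypical δ (codeword Q m + d) (codeword Q (subMsg H v)))
  let B (m v) (H : Matrix μ κ (ZMod q)) (Q : Matrix ρ (κ ⊕ μ) (ZMod q)) : ℝ :=
    ind (τ₀ ≤ carryWeight (codeword Q m + d)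
        (carry (codeword Q m + d) (codeword Q (subMsg H v))) ∧
      collisions Q H (codeword Q m + d) v < τ₁)
  let C (m v) (H : Matrix μ κ (ZMod q)) (Q : Matrix ρ (κ ⊕ μ) (ZMod q)) : ℝ :=
    ∑ u : κ → ZMod q, ind (subMsg H u ∉ Submodule.span (ZMod q) {m, subMsg H v}) *
      (ind (IsTypical δ (codeword Q m + d) (codeword Q (subMsg H v))) *
        ind (carry (codeword Q m + d) (codeword Q (subMsg H u)) =
          carry (codeword Q m + d) (codeword Q (subMsg H v))))
  have hC₀ (m v) (H : Matrix μ κ (ZMod q)) (Q : Matrix ρ (κ ⊕ μ) (ZMod q)) : 0 ≤ C m v H Q :=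
    Finset.sum_nonneg fun u _ =>
      mul_nonneg (ind_nonneg _) (mul_nonneg (ind_nonneg _) (ind_nonneg _))
  have hpoint (m v) (H : Matrix μ κ (ZMod q)) (Q : Matrix ρ (κ ⊕ μ) (ZMod q)) :
      ind (¬(τ₁ ≤ collisions Q H (codeword Q m + d) v ∧
        collisions Q H (codeword Q m + d) v ≤ (q : ℝ) ^ 2 + τ₂)) ≤
      A m v H Q + B m v H Q + C m v H Q / τ₂ := by
    have hA : 0 ≤ A m v H Q := ind_nonneg _
    have hB : 0 ≤ B m v H Q := ind_nonneg _
    have hC : 0 ≤ C m v H Q / τ₂ := div_nonneg (hC₀ _ _ _ _) hτ₂pos.le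
    by_cases htyp : IsTypical δ (codeword Q m + d) (codeword Q (subMsg H v))
    swap
    · have : A m v H Q = 1 := ind_of htyp
      linarith [ind_le_one (¬(τ₁ ≤ collisions Q H (codeword Q m + d) v ∧
        collisions Q H (codeword Q m + d) v ≤ (q : ℝ) ^ 2 + τ₂))]
    by_cases hlow : τ₁ ≤ collisions Q H (codeword Q m + d) v
    swap
    · have : B m v H Q = 1 := ind_of ⟨by rw [hτ₀, ← hn]; exact htyp.1, not_le.1 hlow⟩
      linarith [ind_le_one (¬(τ₁ ≤ collisions Q H (codeword Q m + d) v ∧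
        collisions Q H (codeword Q m + d) v ≤ (q : ℝ) ^ 2 + τ₂))]
    by_cases hup : collisions Q H (codeword Q m + d) v ≤ (q : ℝ) ^ 2 + τ₂
    · rw [ind_of_not (not_not.2 ⟨hlow, hup⟩)]
      positivity
    -- Dependent messages are counted without regard to collision: the span of two vectors has at
    -- most `q ^ 2` elements and `subMsg H` is injective.
    have hle : collisions Q H (codeword Q m + d) v ≤ (q : ℝ) ^ 2 + C m v H Q := by
      refine le_trans ?_ (add_le_add_left
        (sum_ind_mem_span_pair_le (subMsg_injective H) m (subMsg H v)) _)
      rw [collisions, ← Finset.sum_add_distrib]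
      refine Finset.sum_le_sum fun u _ => ?_
      rw [ind_of htyp, one_mul]
      by_cases hu : subMsg H u ∈ Submodule.span (ZMod q) {m, subMsg H v}
      · rw [ind_of hu, ind_of_not (not_not.2 hu), zero_mul, add_zero]
        exact ind_le_one _
      · rw [ind_of hu, ind_of_not hu, one_mul, zero_add]
    have h1 : 1 ≤ C m v H Q / τ₂ := by
      rw [one_le_div hτ₂pos]
      linarith
    linarith [ind_le_one (¬(τ₁ ≤ collisions Q H (codeword Q m + d) v ∧
      collisions Q H (codeword Q m + d) v ≤ (q : ℝ) ^ 2 + τ₂))]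
  have hEA : 𝔼 m, 𝔼 v, 𝔼 H, 𝔼 Q, A m v H Q ≤
      (𝔼 p, (carryInfo q p - capD q) ^ 2) / (n * δ ^ 2) +
        (q : ℝ) / (q : ℝ) ^ Fintype.card (κ ⊕ μ) + 2 / (q : ℝ) ^ Fintype.card κ := by
    refine (expect_ensemble_le d (fun s t => ind (¬IsTypical δ s t)) (fun _ _ => ind_nonneg _)
      (fun _ _ => ind_le_one _)).trans ?_
    rw [← hn]
    gcongr
    exact expect_ind_not_isTypical_le hδ
  -- This bound holds for every fixed `m`, `H`, `Q`; only `v` is averaged.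
  have hEB : 𝔼 m, 𝔼 v, 𝔼 H, 𝔼 Q, B m v H Q ≤ (2 : ℝ) ^ (-((n : ℝ) * δ)) := by
    refine Finset.expect_le Finset.univ_nonempty fun m _ => ?_
    rw [Finset.expect_comm]
    refine Finset.expect_le Finset.univ_nonempty fun H _ => ?_
    rw [Finset.expect_comm]
    refine Finset.expect_le Finset.univ_nonempty fun Q _ => ?_
    have h := sum_ind_small_class_le
      (fun v => carry (codeword Q m + d) (codeword Q (subMsg H v)))
      (carryWeight (codeword Q m + d)) (carryWeight_nonneg _) (sum_carryWeight_le _ _)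
      hτ₀pos hτ₁pos.le
    rw [Fintype.expect_eq_sum_div_card, Fintype.card_fun, ZMod.card, Nat.cast_pow,
      div_le_iff₀ (by positivity)]
    refine h.trans (le_of_eq ?_)
    rw [hτ₁, hτ₀, mul_div_assoc, ← Real.rpow_sub (by norm_num), mul_comm]
    congr 2
    ring
  have hEC : 𝔼 m, 𝔼 v, 𝔼 H, 𝔼 Q, C m v H Q / τ₂ ≤ (2 : ℝ) ^ (-((n : ℝ) * δ)) := by
    refine Finset.expect_le Finset.univ_nonempty fun m _ => ?_
    refine Finset.expect_le Finset.univ_nonempty fun v _ => ?_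
    have h := expect_sum_ind_carry_le d (fun s t => ind (IsTypical δ s t))
      (fun _ _ => ind_nonneg _) m v
    simp only [← Finset.expect_div]
    rw [div_le_iff₀ hτ₂pos]
    refine h.trans ?_
    have h2 : (2 : ℝ) ^ (-((n : ℝ) * δ)) * τ₂ =
        (q : ℝ) ^ Fintype.card κ * (2 : ℝ) ^ (-((n : ℝ) * (capD q - δ))) := by
      rw [hτ₂, mul_left_comm, ← Real.rpow_add (by norm_num)]
      congr 2
      ring
    rw [h2]
    gcongr
    refine Finset.expect_le Finset.univ_nonempty fun H _ => ?_
    refine Finset.expect_le Finset.univ_nonempty fun Q _ => ?_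
    by_cases htyp : IsTypical δ (codeword Q m + d) (codeword Q (subMsg H v))
    · rw [ind_of htyp, one_mul, ← hn]
      exact htyp.2
    · rw [ind_of_not htyp, zero_mul]
      positivity
  calc _ ≤ 𝔼 m, 𝔼 v, 𝔼 H, 𝔼 Q, (A m v H Q + B m v H Q + C m v H Q / τ₂) :=
        Finset.expect_le_expect fun m _ => Finset.expect_le_expect fun v _ =>
          Finset.expect_le_expect fun H _ => Finset.expect_le_expect fun Q _ => hpoint m v H Q
    _ ≤ _ := by
        simp only [Finset.expect_add_distrib]
        linarith

end Ensemble

/-! ### The distribution on the sumset in terms of collision numbers. -/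

section InducedDist

/-- A word over `𝔽_q` as a word of integers in `{0, …, q - 1}`. -/
def intWord {q : ℕ} {ι : Type*} (t : ι → ZMod q) : ι → ℤ := fun i => (t i).val

theorem intWord_injective {q : ℕ} [NeZero q] {ι : Type*} :
    Function.Injective (intWord : (ι → ZMod q) → ι → ℤ) := fun _ _ h =>
  funext fun i => ZMod.val_injective q (Nat.cast_injective (R := ℤ) (congrFun h i))

theorem intWord_sub_add_eq_iff {q : ℕ} [NeZero q] {ι : Type*} (s t s' t' : ι → ZMod q) :
    intWord (s - t) + intWord t = intWord (s' - t') + intWord t' ↔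
      s = s' ∧ carry s t = carry s' t' := by
  simp only [funext_iff, ← forall_and]
  exact forall_congr' fun i => ZMod.val_sub_add_val_eq_iff _ _ _ _

theorem codeword_injective {q : ℕ} {κ μ ρ : Type*} [Fintype κ] [Fintype μ]
    (Q : Matrix ρ (κ ⊕ μ) (ZMod q)) : Function.Injective (codeword Q) :=
  fun _ _ h => funext fun i => congrFun h (Sum.inl i)

theorem codeword_sub {q : ℕ} {κ μ ρ : Type*} [Fintype κ] [Fintype μ]
    (Q : Matrix ρ (κ ⊕ μ) (ZMod q)) (m x : κ ⊕ μ → ZMod q) :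
    codeword Q (m - x) = codeword Q m - codeword Q x := by
  ext (i | i) <;> simp [codeword, Matrix.mulVec_sub]

theorem fromRows_one_mulVec {q : ℕ} {κ μ ρ : Type*} [Fintype κ] [Fintype μ]
    [DecidableEq κ] [DecidableEq μ] (Q : Matrix ρ (κ ⊕ μ) (ZMod q)) (m : κ ⊕ μ → ZMod q) :
    Matrix.fromRows 1 Q *ᵥ m = codeword Q m := by
  rw [Matrix.fromRows_mulVec, Matrix.one_mulVec, codeword]

variable {q n k₁ k₂ : ℕ} [NeZero q] (Q : Matrix (Fin (n - k₁)) (MsgIdx k₁ k₂) (ZMod q))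
  (H : Matrix (Fin (k₁ - k₂)) (Fin k₂) (ZMod q)) (d : CodeIdx n k₁ k₂ → ZMod q)

theorem toInt_coset_code₁ : toInt (coset (code₁ Q) d) =
    Finset.univ.image fun m => intWord (codeword Q m + d) := by
  rw [toInt, coset, code₁, Finset.image_image, Finset.image_image]
  simp only [Function.comp_def, fromRows_one_mulVec]
  rfl

theorem toInt_code₂ : toInt (code₂ Q H) =
    Finset.univ.image fun v => intWord (codeword Q (subMsg H v)) := by
  rw [toInt, code₂, Finset.image_image]
  simp only [Function.comp_def, fromRows_one_mulVec]
  rfl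

/-- The sum of the codewords of the coset and of the subcode, parametrized by the message of their
sum modulo `q` and the parameter of the latter. -/
def sumWord (p : (MsgIdx k₁ k₂ → ZMod q) × (Fin k₂ → ZMod q)) : CodeIdx n k₁ k₂ → ℤ :=
  intWord (codeword Q p.1 + d - codeword Q (subMsg H p.2)) + intWord (codeword Q (subMsg H p.2))

theorem sumWord_mem (p) : sumWord Q H d p ∈ codeSumset Q H d := by
  rw [codeSumset, toInt_coset_code₁, toInt_code₂]
  refine Finset.add_mem_add (Finset.mem_image.2 ⟨p.1 - subMsg H p.2, Finset.mem_univ _, ?_⟩)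
    (Finset.mem_image_of_mem _ (Finset.mem_univ _))
  rw [codeword_sub, sub_add_eq_add_sub]

/-- Nestedness enters here: for fixed `v`, the shift `m ↦ m + subMsg H v` is a bijection of
messages, which replaces the first summand by the sum modulo `q`. -/
theorem inducedDist_toReal (w : CodeIdx n k₁ k₂ → ℤ) :
    (inducedDist Q H d w).toReal = 𝔼 p, ind (sumWord Q H d p = w) := by
  have h₁ : Function.Injective fun m => intWord (codeword Q m + d) :=
    intWord_injective.comp ((add_left_injective d).comp (codeword_injective Q))
  have h₂ : Function.Injective fun v => intWord (codeword Q (subMsg H v)) :=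
    intWord_injective.comp ((codeword_injective Q).comp (subMsg_injective H))
  rw [inducedDist, sumDist]
  simp only [toInt_coset_code₁, toInt_code₂]
  rw [PMF.uniformOfFinset_image h₁, PMF.uniformOfFinset_image h₂, PMF.bind_map]
  simp only [Function.comp_def, PMF.map_comp]
  rw [PMF.bind_map_uniformOfFintype_toReal, ← Finset.univ_product_univ, Finset.expect_product,
    Finset.expect_comm]
  conv_rhs => rw [Finset.expect_comm]
  refine Finset.expect_congr rfl fun v _ => ?_
  refine Fintype.expect_equiv (Equiv.addRight (subMsg H v)) _ _ fun m => ?_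
  simp only [sumWord, Equiv.coe_addRight]
  rw [← sub_add_eq_add_sub, ← codeword_sub, add_sub_cancel_right]

/-- An integer sum fixes its residue, hence `p.1`, so only the parameters `v` with equal carries
contribute. -/
theorem inducedDist_sumWord [Fact q.Prime] (hk : k₂ ≤ k₁)
    (p : (MsgIdx k₁ k₂ → ZMod q) × (Fin k₂ → ZMod q)) :
    (inducedDist Q H d (sumWord Q H d p)).toReal =
      collisions Q H (codeword Q p.1 + d) p.2 / ((q : ℝ) ^ k₁ * (q : ℝ) ^ k₂) := by
  have hcard : Fintype.card (MsgIdx k₁ k₂) = k₁ := by simp [MsgIdx, hk]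
  rw [inducedDist_toReal, Fintype.expect_eq_sum_div_card, Fintype.card_prod, Fintype.card_fun,
    Fintype.card_fun, ZMod.card, hcard, Fintype.card_fin, Nat.cast_mul, Nat.cast_pow,
    Nat.cast_pow, ← Finset.univ_product_univ, Finset.sum_product, Finset.sum_eq_single p.1]
  · congr 1
    refine Finset.sum_congr rfl fun v _ => ?_
    congr 1
    rw [sumWord, sumWord, intWord_sub_add_eq_iff]
    simp
  · intro m _ hm
    refine Finset.sum_eq_zero fun v _ => ind_of_not ?_
    rw [sumWord, sumWord, intWord_sub_add_eq_iff]
    exact fun h => hm (codeword_injective Q (add_left_injective d h.1))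
  · simp

theorem inducedDist_toOuterMeasure (K : Finset (CodeIdx n k₁ k₂ → ℤ)) :
    ((inducedDist Q H d).toOuterMeasure (K : Set _)).toReal = 𝔼 p, ind (sumWord Q H d p ∈ K) := by
  rw [PMF.toOuterMeasure_apply_finset, ENNReal.toReal_sum fun w _ => PMF.apply_ne_top _ _]
  simp only [inducedDist_toReal]
  have := sum_expect_ind_mul (sumWord Q H d) K fun _ => 1
  simpa only [mul_one] using this

theorem ExpClose.mono {n : ℕ} {ε ε' a b : ℝ} (hb : 0 ≤ b) (hε : ε ≤ ε') (h : ExpClose n ε a b) :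
    ExpClose n ε' a b := by
  have hn : (0 : ℝ) ≤ n := Nat.cast_nonneg n
  refine ⟨le_trans ?_ h.1, h.2.trans ?_⟩ <;>
    refine mul_le_mul_of_nonneg_right (Real.rpow_le_rpow_of_exponent_le (by norm_num) ?_) hb <;>
    nlinarith

/-- If the probability of almost every sum is close to `B`, then the sumset is normal typical. -/
theorem exists_typical_sumset [Fact q.Prime] (hk : k₂ ≤ k₁) {ε A B : ℝ} (hε : 0 ≤ ε) (hB : 0 < B)
    (hAB : A * B = 1) (h2 : 2 ≤ (2 : ℝ) ^ ((n : ℝ) * (ε / 2)))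
    (hbad : 𝔼 m, 𝔼 v, ind (¬ExpClose n (ε / 2)
      (collisions Q H (codeword Q m + d) v / ((q : ℝ) ^ k₁ * (q : ℝ) ^ k₂)) B) ≤ min ε (1 / 2)) :
    ∃ K : Finset (CodeIdx n k₁ k₂ → ℤ), K ⊆ codeSumset Q H d ∧
      1 - ε ≤ ((inducedDist Q H d).toOuterMeasure (K : Set _)).toReal ∧
      ExpClose n ε (K.card : ℝ) A ∧
      ∀ w ∈ K, ExpClose n ε (inducedDist Q H d w).toReal B := by
  classical
  set K := (codeSumset Q H d).filter fun w => ExpClose n (ε / 2) (inducedDist Q H d w).toReal B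
    with hKdef
  set x := (2 : ℝ) ^ ((n : ℝ) * (ε / 2)) with hx
  have hx0 : 0 < x := by positivity
  have hxinv : (2 : ℝ) ^ (-((n : ℝ) * (ε / 2))) = x⁻¹ := Real.rpow_neg (by norm_num) _
  have hxx : (2 : ℝ) ^ ((n : ℝ) * ε) = x * x := by
    rw [hx, ← Real.rpow_add (by norm_num)]; congr 1; ring
  have hxxinv : (2 : ℝ) ^ (-((n : ℝ) * ε)) = x⁻¹ * x⁻¹ := by
    rw [Real.rpow_neg (by norm_num), hxx, mul_inv]
  have hA : A = B⁻¹ := eq_inv_of_mul_eq_one_left hAB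
  have hA0 : 0 < A := hA ▸ inv_pos.2 hB
  have hprob : ((inducedDist Q H d).toOuterMeasure (K : Set _)).toReal =
      ∑ w ∈ K, (inducedDist Q H d w).toReal := by
    rw [PMF.toOuterMeasure_apply_finset, ENNReal.toReal_sum fun w _ => PMF.apply_ne_top _ _]
  have hge : 1 - min ε (1 / 2) ≤ ((inducedDist Q H d).toOuterMeasure (K : Set _)).toReal := by
    rw [inducedDist_toOuterMeasure, ← Finset.univ_product_univ, Finset.expect_product]
    refine (sub_le_sub_left hbad 1).trans (le_of_eq ?_)
    rw [sub_eq_iff_eq_add]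
    simp only [← Finset.expect_add_distrib]
    have h (m v) : ind (sumWord Q H d (m, v) ∈ K) + ind (¬ExpClose n (ε / 2)
        (collisions Q H (codeword Q m + d) v / ((q : ℝ) ^ k₁ * (q : ℝ) ^ k₂)) B) = 1 := by
      have hiff : sumWord Q H d (m, v) ∈ K ↔ ExpClose n (ε / 2)
          (collisions Q H (codeword Q m + d) v / ((q : ℝ) ^ k₁ * (q : ℝ) ^ k₂)) B := by
        rw [hKdef, Finset.mem_filter, inducedDist_sumWord Q H d hk (m, v)]
        exact and_iff_right (sumWord_mem Q H d (m, v))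
      rw [hiff]
      by_cases hE : ExpClose n (ε / 2)
          (collisions Q H (codeword Q m + d) v / ((q : ℝ) ^ k₁ * (q : ℝ) ^ k₂)) B
      · rw [ind_of hE, ind_of_not (not_not.2 hE), add_zero]
      · rw [ind_of hE, ind_of_not hE, zero_add]
    simp only [h, Fintype.expect_const]
  have hle : ((inducedDist Q H d).toOuterMeasure (K : Set _)).toReal ≤ 1 := by
    rw [inducedDist_toOuterMeasure]
    exact Finset.expect_le Finset.univ_nonempty fun _ _ => ind_le_one _
  refine ⟨K, Finset.filter_subset _ _, (sub_le_sub_left (min_le_left _ _) 1).trans hge, ⟨?_, ?_⟩,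
    fun w hw => (Finset.mem_filter.1 hw).2.mono hB.le (by linarith)⟩
  -- Mass at least `1 / 2` on points of probability at most `x * B` forces many points. The lost
  -- factor `2` is absorbed by one `x`, which is why the points are selected with tolerance `ε / 2`.
  · have h1 : 1 / 2 ≤ K.card * (x * B) := by
      rw [← nsmul_eq_mul]
      have h3 := Finset.sum_le_card_nsmul K (fun w => (inducedDist Q H d w).toReal) (x * B)
        fun w hw => (Finset.mem_filter.1 hw).2.2
      linarith [min_le_right ε (1 / 2)]
    rw [hxxinv, hA]
    have h4 : x⁻¹ ≤ 1 / 2 := by rw [one_div]; exact inv_anti₀ (by norm_num) h2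
    calc x⁻¹ * x⁻¹ * B⁻¹ = (x⁻¹ * B⁻¹) * x⁻¹ := by ring
      _ ≤ (x⁻¹ * B⁻¹) * (K.card * (x * B)) := by gcongr; exact h4.trans h1
      _ = K.card := by field_simp
  · have h1 : K.card * (x⁻¹ * B) ≤ 1 := by
      rw [← nsmul_eq_mul]
      refine (Finset.card_nsmul_le_sum _ _ _ fun w hw => ?_).trans (hprob.symm.le.trans hle)
      have := (Finset.mem_filter.1 hw).2.1
      rwa [hxinv] at this
    rw [hxx, hA]
    calc (K.card : ℝ) = (K.card * (x⁻¹ * B)) * (x * B⁻¹) := by field_simp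
      _ ≤ 1 * (x * B⁻¹) := by gcongr
      _ ≤ x * x * B⁻¹ := by
        rw [one_mul, mul_assoc]
        exact le_mul_of_one_le_left (by positivity) (by linarith)

theorem ensemble_toOuterMeasure (S : Set (Matrix (Fin (n - k₁)) (MsgIdx k₁ k₂) (ZMod q) ×
      Matrix (Fin (k₁ - k₂)) (Fin k₂) (ZMod q))) :
    ((ensemble q n k₁ k₂).toOuterMeasure S).toReal = 𝔼 p, ind (p ∈ S) := by
  classical
  rw [ensemble, PMF.toOuterMeasure_uniformOfFintype_apply, ENNReal.toReal_div, expect_ind,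
    Fintype.card_subtype]
  simp

end InducedDist

/-! ### Asymptotics and passage to vanishing tolerances. -/

/-- Markov's inequality for averages. -/
theorem one_sub_le_expect_ind {Ω : Type*} [Fintype Ω] [Nonempty Ω] (β : Ω → ℝ) (hβ : ∀ ω, 0 ≤ β ω)
    {c : ℝ} (hc : 0 < c) : 1 - (𝔼 ω, β ω) / c ≤ 𝔼 ω, ind (β ω ≤ c) := by
  rw [sub_le_iff_le_add, Finset.expect_div, ← Finset.expect_add_distrib]
  refine Finset.le_expect Finset.univ_nonempty fun ω _ => ?_
  by_cases h : β ω ≤ c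
  · rw [ind_of h]
    linarith [div_nonneg (hβ ω) hc.le]
  · rw [ind_of_not h, zero_add, one_le_div hc]
    exact (not_le.1 h).le

/-- If `f · ε` tends to `1` for every `ε > 0`, then so it does along some sequence decreasing
to `0`. -/
theorem exists_antitone_tendsto_one (f : ℕ → ℝ → ℝ) (h₀ : ∀ n ε, 0 ≤ f n ε)
    (h₁ : ∀ n ε, f n ε ≤ 1) (hf : ∀ ε > 0, Tendsto (fun n => f n ε) atTop (𝓝 1)) :
    ∃ ε : ℕ → ℝ, Antitone ε ∧ Tendsto ε atTop (𝓝 0) ∧ Tendsto (fun n => f n (ε n)) atTop (𝓝 1) := by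
  classical
  let e (j : ℕ) : ℝ := 1 / ((j : ℝ) + 1)
  let P (n j : ℕ) : Prop := ∀ n' ≥ n, 1 - e j ≤ f n' (e j)
  let j (n : ℕ) : ℕ := Nat.findGreatest (P n) n
  have he : Antitone e := fun a b h => by
    simp only [e]
    gcongr
  have hP (n : ℕ) : P n (j n) := by
    -- Index `0` always qualifies, as `e 0 = 1` makes the requirement `0 ≤ f`. The quantifier over
    -- all `n' ≥ n` in `P` is what makes `j` monotone.
    refine Nat.findGreatest_spec (P := P n) (Nat.zero_le n) fun n' _ => ?_
    simpa [e] using h₀ n' 1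
  have hmono : Monotone j := fun a b h =>
    (Nat.findGreatest_mono_left (fun i hi n' hn' => hi n' (h.trans hn')) a).trans
      (Nat.findGreatest_mono_right _ h)
  have htop : Tendsto j atTop atTop := by
    refine tendsto_atTop.2 fun i => ?_
    have hpos : 0 < e i := by positivity
    obtain ⟨N, hN⟩ := eventually_atTop.1
      ((hf (e i) hpos).eventually (eventually_ge_nhds (show 1 - e i < 1 by linarith)))
    filter_upwards [eventually_ge_atTop N, eventually_ge_atTop i] with n hn hi
    exact Nat.le_findGreatest hi fun n' hn' => hN n' (hn.trans hn')
  have hlim : Tendsto (fun n => e (j n)) atTop (𝓝 0) :=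
    tendsto_one_div_add_atTop_nhds_zero_nat.comp htop
  refine ⟨fun n => e (j n), he.comp_monotone hmono, hlim, ?_⟩
  refine tendsto_of_tendsto_of_tendsto_of_le_of_le ?_ tendsto_const_nhds
    (fun n => hP n n le_rfl) fun n => h₁ _ _
  simpa using (tendsto_const_nhds (x := (1 : ℝ))).sub hlim

theorem natCast_pow_eq_two_rpow {q : ℕ} (hq : 0 < q) (k : ℕ) :
    (q : ℝ) ^ k = (2 : ℝ) ^ ((k : ℝ) * Real.logb 2 q) := by
  rw [mul_comm, Real.rpow_mul (by norm_num), Real.rpow_logb (by norm_num) (by norm_num)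
    (Nat.cast_pos.2 hq), Real.rpow_natCast]

/-- Here `x` is a collision number and `2 ^ a`, `2 ^ b` are the code sizes. The tolerance `4 * δ`
covers the rate errors and the slack `2 * δ` in the collision bounds, plus one `δ` for the prefactor
`C + 1`. The trivial bound `1 ≤ x` gives the first term of the maximum. -/
theorem expClose_max_of_bounds {n : ℕ} {a b R₁ R₂ D δ x C : ℝ}
    (ha : |a - n * R₁| ≤ n * δ) (hb : |b - n * R₂| ≤ n * δ) (hδ : 0 ≤ δ) (hC : 0 ≤ C)
    (hCδ : C + 1 ≤ (2 : ℝ) ^ ((n : ℝ) * δ)) (h1 : 1 ≤ x)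
    (hlow : (2 : ℝ) ^ b * (2 : ℝ) ^ (-((n : ℝ) * (D + 2 * δ))) ≤ x)
    (hup : x ≤ C + (2 : ℝ) ^ b * (2 : ℝ) ^ (-((n : ℝ) * (D - 2 * δ)))) :
    ExpClose n (4 * δ) (x / ((2 : ℝ) ^ a * (2 : ℝ) ^ b))
      (max ((2 : ℝ) ^ (-((n : ℝ) * (R₁ + R₂)))) ((2 : ℝ) ^ (-((n : ℝ) * (R₁ + D))))) := by
  have h2 : (0 : ℝ) < 2 := by norm_num
  have h12 : (1 : ℝ) ≤ 2 := by norm_num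
  have hnδ : 0 ≤ n * δ := by positivity
  rw [abs_le] at ha hb
  constructor
  · rw [mul_max_of_nonneg _ _ (by positivity), ← Real.rpow_add h2, ← Real.rpow_add h2,
      le_div_iff₀ (by positivity), max_mul_of_nonneg _ _ (by positivity), ← Real.rpow_add h2,
      ← Real.rpow_add h2, ← Real.rpow_add h2]
    refine max_le ((Real.rpow_le_one_of_one_le_of_nonpos h12 ?_).trans h1) (le_trans ?_ hlow)
    · linarith
    · rw [← Real.rpow_add h2]
      exact Real.rpow_le_rpow_of_exponent_le h12 (by linarith)
  · set B := max ((2 : ℝ) ^ (-((n : ℝ) * (R₁ + R₂)))) ((2 : ℝ) ^ (-((n : ℝ) * (R₁ + D)))) with hB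
    have hB0 : 0 < B := lt_max_of_lt_left (by positivity)
    have hBC : ((2 : ℝ) ^ a * (2 : ℝ) ^ b)⁻¹ ≤ (2 : ℝ) ^ ((n : ℝ) * (3 * δ)) * B := by
      refine le_trans ?_ (mul_le_mul_of_nonneg_left (le_max_left _ _) (by positivity))
      rw [← Real.rpow_add h2, ← Real.rpow_neg h2.le, ← Real.rpow_add h2]
      exact Real.rpow_le_rpow_of_exponent_le h12 (by linarith)
    have hBD : (2 : ℝ) ^ b * (2 : ℝ) ^ (-((n : ℝ) * (D - 2 * δ))) * ((2 : ℝ) ^ a * (2 : ℝ) ^ b)⁻¹ ≤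
        (2 : ℝ) ^ ((n : ℝ) * (3 * δ)) * B := by
      refine le_trans ?_ (mul_le_mul_of_nonneg_left (le_max_right _ _) (by positivity))
      rw [← Real.rpow_add h2, ← Real.rpow_add h2, ← Real.rpow_neg h2.le, ← Real.rpow_add h2,
        ← Real.rpow_add h2]
      exact Real.rpow_le_rpow_of_exponent_le h12 (by linarith)
    calc x / ((2 : ℝ) ^ a * (2 : ℝ) ^ b)
        ≤ (C + (2 : ℝ) ^ b * (2 : ℝ) ^ (-((n : ℝ) * (D - 2 * δ)))) *
            ((2 : ℝ) ^ a * (2 : ℝ) ^ b)⁻¹ := by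
          rw [div_eq_mul_inv]; gcongr
      _ = C * ((2 : ℝ) ^ a * (2 : ℝ) ^ b)⁻¹ + (2 : ℝ) ^ b *
            (2 : ℝ) ^ (-((n : ℝ) * (D - 2 * δ))) * ((2 : ℝ) ^ a * (2 : ℝ) ^ b)⁻¹ := by ring
      _ ≤ C * ((2 : ℝ) ^ ((n : ℝ) * (3 * δ)) * B) + (2 : ℝ) ^ ((n : ℝ) * (3 * δ)) * B := by gcongr
      _ = (C + 1) * ((2 : ℝ) ^ ((n : ℝ) * (3 * δ)) * B) := by ring
      _ ≤ (2 : ℝ) ^ ((n : ℝ) * δ) * ((2 : ℝ) ^ ((n : ℝ) * (3 * δ)) * B) := by gcongr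
      _ = _ := by
          rw [← mul_assoc, ← Real.rpow_add h2]
          congr 2
          ring

theorem expClose_max_of_rate_zero {n : ℕ} {a b R₁ D δ x : ℝ}
    (ha : |a - n * R₁| ≤ n * δ) (hb : |b| ≤ n * δ) (hδ : 0 ≤ δ) (hD : 0 ≤ D) (h1 : 1 ≤ x)
    (hx : x ≤ (2 : ℝ) ^ b) :
    ExpClose n (4 * δ) (x / ((2 : ℝ) ^ a * (2 : ℝ) ^ b))
      (max ((2 : ℝ) ^ (-((n : ℝ) * (R₁ + 0)))) ((2 : ℝ) ^ (-((n : ℝ) * (R₁ + D))))) := by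
  have h2 : (0 : ℝ) < 2 := by norm_num
  have h12 : (1 : ℝ) ≤ 2 := by norm_num
  have hnδ : 0 ≤ n * δ := by positivity
  have hnD : 0 ≤ n * D := by positivity
  rw [abs_le] at ha hb
  rw [max_eq_left (Real.rpow_le_rpow_of_exponent_le h12 (by linarith))]
  rw [ExpClose, ← Real.rpow_add h2, ← Real.rpow_add h2, ← Real.rpow_add h2,
    le_div_iff₀ (by positivity), div_le_iff₀ (by positivity), ← Real.rpow_add h2,
    ← Real.rpow_add h2]
  exact ⟨(Real.rpow_le_one_of_one_le_of_nonpos h12 (by linarith)).trans h1,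
    hx.trans (Real.rpow_le_rpow_of_exponent_le h12 (by linarith))⟩

theorem tendsto_two_rpow_mul_atTop {δ : ℝ} (hδ : 0 < δ) :
    Tendsto (fun n : ℕ => (2 : ℝ) ^ ((n : ℝ) * δ)) atTop atTop := by
  have h : 1 < (2 : ℝ) ^ δ := Real.one_lt_rpow (by norm_num) hδ
  refine (tendsto_pow_atTop_atTop_of_one_lt h).congr fun n => ?_
  rw [← Real.rpow_natCast, ← Real.rpow_mul (by norm_num), mul_comm]

theorem eventually_abs_sub_le {k : ℕ → ℕ} {L R : ℝ}
    (hR : Tendsto (fun n : ℕ => (k n : ℝ) / (n : ℝ) * L) atTop (𝓝 R)) {δ : ℝ} (hδ : 0 < δ) :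
    ∀ᶠ n : ℕ in atTop, |(k n : ℝ) * L - n * R| ≤ n * δ := by
  filter_upwards [(Metric.tendsto_nhds.1 hR) δ hδ, eventually_gt_atTop 0] with n hn hn0
  have hn' : (0 : ℝ) < n := Nat.cast_pos.2 hn0
  rw [Real.dist_eq] at hn
  have : (k n : ℝ) * L - n * R = n * ((k n : ℝ) / n * L - R) := by field_simp
  rw [this, abs_mul, abs_of_pos hn']
  gcongr

theorem tendsto_atTop_of_rate_pos {k : ℕ → ℕ} {L R : ℝ} (hL : 0 < L)
    (hR : Tendsto (fun n : ℕ => (k n : ℝ) / (n : ℝ) * L) atTop (𝓝 R)) (hpos : 0 < R) :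
    Tendsto k atTop atTop := by
  rw [← tendsto_natCast_atTop_iff (R := ℝ)]
  have h := (hR.pos_mul_atTop hpos (tendsto_natCast_atTop_atTop (R := ℝ))).atTop_div_const hL
  refine h.congr' ?_
  filter_upwards [eventually_gt_atTop 0] with n hn
  have hn' : (n : ℝ) ≠ 0 := Nat.cast_ne_zero.2 hn.ne'
  field_simp

theorem card_codeIdx {n k₁ k₂ : ℕ} (h₂ : k₂ ≤ k₁) (h₁ : k₁ ≤ n) :
    Fintype.card (CodeIdx n k₁ k₂) = n := by
  simp [CodeIdx, MsgIdx, h₁, h₂]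

/-- On average over the ensemble, the probability that the probability of the random sum is not
close to its typical value tends to `0`. -/
theorem tendsto_expect_ind_not_expClose (q : ℕ) [Fact q.Prime] (k₁ k₂ : ℕ → ℕ)
    (hk₂ : ∀ n, k₂ n ≤ k₁ n) (hk₁ : ∀ n, k₁ n ≤ n) {R₁ R₂ : ℝ}
    (hR₁ : Tendsto (fun n : ℕ => (k₁ n : ℝ) / (n : ℝ) * Real.logb 2 (q : ℝ)) atTop (𝓝 R₁))
    (hR₂ : Tendsto (fun n : ℕ => (k₂ n : ℝ) / (n : ℝ) * Real.logb 2 (q : ℝ)) atTop (𝓝 R₂))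
    (d : ∀ n : ℕ, CodeIdx n (k₁ n) (k₂ n) → ZMod q) {ε : ℝ} (hε : 0 < ε) :
    Tendsto (fun n : ℕ => 𝔼 m, 𝔼 v, 𝔼 H : Matrix (Fin (k₁ n - k₂ n)) (Fin (k₂ n)) (ZMod q),
      𝔼 Q : Matrix (Fin (n - k₁ n)) (MsgIdx (k₁ n) (k₂ n)) (ZMod q),
        ind (¬ExpClose n ε
          (collisions Q H (codeword Q m + d n) v / ((q : ℝ) ^ k₁ n * (q : ℝ) ^ k₂ n))
          (max ((2 : ℝ) ^ (-((n : ℝ) * (R₁ + R₂))))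
            ((2 : ℝ) ^ (-((n : ℝ) * (max R₁ R₂ + capD q))))))) atTop (𝓝 0) := by
  have hqp : q.Prime := Fact.out
  have hq1 : (1 : ℝ) < q := Nat.one_lt_cast.2 hqp.one_lt
  have hL : 0 < Real.logb 2 (q : ℝ) := Real.logb_pos (by norm_num) hq1
  obtain ⟨δ, hδ, rfl⟩ : ∃ δ : ℝ, 0 < δ ∧ ε = 4 * δ := ⟨ε / 4, by positivity, by ring⟩
  have hR₂₁ : R₂ ≤ R₁ := le_of_tendsto_of_tendsto' hR₂ hR₁ fun n => by
    gcongr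
    exact hk₂ n
  have hR₂0 : 0 ≤ R₂ := ge_of_tendsto' hR₂ fun n => by positivity
  rw [max_eq_left hR₂₁]
  simp only [natCast_pow_eq_two_rpow hqp.pos]
  -- If `R₂ = 0`, then `k₂` need not tend to infinity and the error `2 / q ^ k₂` need not vanish.
  -- The trivial bounds `1 ≤ N ≤ q ^ k₂ = 2 ^ (o(n))` then suffice for every code.
  rcases hR₂0.eq_or_lt with rfl | hR₂pos
  · refine tendsto_const_nhds.congr' ?_
    filter_upwards [eventually_abs_sub_le hR₁ hδ, eventually_abs_sub_le hR₂ hδ] with n h₁ h₂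
    rw [mul_zero, sub_zero] at h₂
    symm
    refine Finset.expect_eq_zero fun m _ => Finset.expect_eq_zero fun v _ =>
      Finset.expect_eq_zero fun H _ => Finset.expect_eq_zero fun Q _ => ind_of_not (not_not.2 ?_)
    refine expClose_max_of_rate_zero h₁ h₂ hδ.le (capD_nonneg q) (one_le_collisions _ _ _ _) ?_
    refine (collisions_le _ _ _ _).trans (le_of_eq ?_)
    rw [Fintype.card_fin, natCast_pow_eq_two_rpow hqp.pos]
  have hk₂top := tendsto_atTop_of_rate_pos hL hR₂ hR₂pos
  have hk₁top := tendsto_atTop_of_rate_pos hL hR₁ (hR₂pos.trans_le hR₂₁)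
  have hpow := tendsto_pow_atTop_atTop_of_one_lt hq1
  have hbound : Tendsto (fun n : ℕ => (𝔼 p, (carryInfo q p - capD q) ^ 2) / (n * δ ^ 2) +
      (q : ℝ) / (q : ℝ) ^ k₁ n + 2 / (q : ℝ) ^ k₂ n + 2 * (2 : ℝ) ^ (-((n : ℝ) * δ)))
      atTop (𝓝 0) := by
    have t₁ : Tendsto (fun n : ℕ => (𝔼 p, (carryInfo q p - capD q) ^ 2) / (n * δ ^ 2)) atTop
        (𝓝 0) :=
      (tendsto_natCast_atTop_atTop.atTop_mul_const (by positivity)).const_div_atTop _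
    have t₂ := (hpow.comp hk₁top).const_div_atTop (q : ℝ)
    have t₃ := (hpow.comp hk₂top).const_div_atTop (2 : ℝ)
    have t₄ : Tendsto (fun n : ℕ => 2 * (2 : ℝ) ^ (-((n : ℝ) * δ))) atTop (𝓝 0) := by
      refine ((tendsto_two_rpow_mul_atTop hδ).const_div_atTop 2).congr fun n => ?_
      rw [Real.rpow_neg (by norm_num), div_eq_mul_inv]
    simpa using ((t₁.add t₂).add t₃).add t₄
  refine tendsto_of_tendsto_of_tendsto_of_le_of_le' tendsto_const_nhds hbound
    (Eventually.of_forall fun n => Finset.expect_nonneg fun _ _ => Finset.expect_nonneg fun _ _ =>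
      Finset.expect_nonneg fun _ _ => Finset.expect_nonneg fun _ _ => ind_nonneg _) ?_
  filter_upwards [eventually_abs_sub_le hR₁ hδ, eventually_abs_sub_le hR₂ hδ,
    eventually_gt_atTop 0,
    (tendsto_two_rpow_mul_atTop hδ).eventually_ge_atTop ((q : ℝ) ^ 2 + 1)] with n h₁ h₂ hn hC
  have hcard := card_codeIdx (hk₂ n) (hk₁ n)
  have : Nonempty (CodeIdx n (k₁ n) (k₂ n)) := Fintype.card_pos_iff.1 (hcard.symm ▸ hn)
  have hcard₁ : Fintype.card (MsgIdx (k₁ n) (k₂ n)) = k₁ n := by simp [MsgIdx, hk₂ n]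
  have h := expect_ind_not_collisions_le (d n) hδ hcard
  rw [hcard₁, Fintype.card_fin] at h
  refine le_trans ?_ h
  refine Finset.expect_le_expect fun m _ => Finset.expect_le_expect fun v _ =>
    Finset.expect_le_expect fun H _ => Finset.expect_le_expect fun Q _ =>
      ind_mono (mt fun hgood => ?_)
  rw [natCast_pow_eq_two_rpow hqp.pos (k₂ n)] at hgood
  exact expClose_max_of_bounds h₁ h₂ hδ.le (by positivity) hC (one_le_collisions _ _ _ _)
    hgood.1 hgood.2

/-- The codes have a normal typical sumset, up to a fixed tolerance `ε`. -/
theorem tendsto_ensemble_typical_sumset (q : ℕ) [Fact q.Prime] (k₁ k₂ : ℕ → ℕ)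
    (hk₂ : ∀ n, k₂ n ≤ k₁ n) (hk₁ : ∀ n, k₁ n ≤ n) (R₁ R₂ : ℝ)
    (hR₁ : Tendsto (fun n : ℕ => (k₁ n : ℝ) / (n : ℝ) * Real.logb 2 (q : ℝ)) atTop (𝓝 R₁))
    (hR₂ : Tendsto (fun n : ℕ => (k₂ n : ℝ) / (n : ℝ) * Real.logb 2 (q : ℝ)) atTop (𝓝 R₂))
    (d : ∀ n : ℕ, CodeIdx n (k₁ n) (k₂ n) → ZMod q) {ε : ℝ} (hε : 0 < ε) :
      Tendsto (fun n : ℕ => ((ensemble q n (k₁ n) (k₂ n)).toOuterMeasure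
          {QH | ∃ K : Finset (CodeIdx n (k₁ n) (k₂ n) → ℤ),
            K ⊆ codeSumset QH.1 QH.2 (d n) ∧
            1 - ε ≤ ((inducedDist QH.1 QH.2 (d n)).toOuterMeasure (K : Set _)).toReal ∧
            ExpClose n ε (K.card : ℝ)
              (min ((2 : ℝ) ^ ((n : ℝ) * (R₁ + R₂)))
                ((2 : ℝ) ^ ((n : ℝ) * (max R₁ R₂ + capD q)))) ∧
            ∀ w ∈ K, ExpClose n ε (inducedDist QH.1 QH.2 (d n) w).toReal
              (max ((2 : ℝ) ^ (-((n : ℝ) * (R₁ + R₂))))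
                ((2 : ℝ) ^ (-((n : ℝ) * (max R₁ R₂ + capD q)))))}).toReal)
        atTop (𝓝 1) := by
  -- Besides the tolerance `ε`, the bad mass is kept below `1 / 2` to ensure the lower bound on the
  -- cardinality.
  have hη : 0 < min ε (1 / 2) := by positivity
  have hT := tendsto_expect_ind_not_expClose q k₁ k₂ hk₂ hk₁ hR₁ hR₂ d (half_pos hε)
  refine tendsto_of_tendsto_of_tendsto_of_le_of_le'
    (by simpa only [zero_div, sub_zero] using
      (tendsto_const_nhds (x := (1 : ℝ))).sub (hT.div_const (min ε (1 / 2))))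
    tendsto_const_nhds ?_ (Eventually.of_forall fun n => by
      rw [ensemble_toOuterMeasure]
      exact Finset.expect_le Finset.univ_nonempty fun _ _ => ind_le_one _)
  filter_upwards [(tendsto_two_rpow_mul_atTop (half_pos hε)).eventually_ge_atTop 2] with n hn
  rw [ensemble_toOuterMeasure]
  set B := max ((2 : ℝ) ^ (-((n : ℝ) * (R₁ + R₂))))
    ((2 : ℝ) ^ (-((n : ℝ) * (max R₁ R₂ + capD q)))) with hB
  set A := min ((2 : ℝ) ^ ((n : ℝ) * (R₁ + R₂)))
    ((2 : ℝ) ^ ((n : ℝ) * (max R₁ R₂ + capD q))) with hA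
  have hB0 : 0 < B := lt_max_of_lt_left (by positivity)
  have hAB : A * B = 1 := by
    have hpos : ∀ x : ℝ, 0 < (2 : ℝ) ^ x := fun x => by positivity
    have h1 : ∀ x : ℝ, (2 : ℝ) ^ x * (2 : ℝ) ^ (-x) = 1 := fun x => by
      rw [← Real.rpow_add (by norm_num), add_neg_cancel, Real.rpow_zero]
    rcases le_total ((n : ℝ) * (R₁ + R₂)) ((n : ℝ) * (max R₁ R₂ + capD q)) with hle | hle
    · rw [hA, hB, min_eq_left (Real.rpow_le_rpow_of_exponent_le (by norm_num) hle),
        max_eq_left (Real.rpow_le_rpow_of_exponent_le (by norm_num) (neg_le_neg hle)), h1]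
    · rw [hA, hB, min_eq_right (Real.rpow_le_rpow_of_exponent_le (by norm_num) hle),
        max_eq_right (Real.rpow_le_rpow_of_exponent_le (by norm_num) (neg_le_neg hle)), h1]
  let β (p : Matrix (Fin (n - k₁ n)) (MsgIdx (k₁ n) (k₂ n)) (ZMod q) ×
      Matrix (Fin (k₁ n - k₂ n)) (Fin (k₂ n)) (ZMod q)) : ℝ :=
    𝔼 m, 𝔼 v, ind (¬ExpClose n (ε / 2)
      (collisions p.1 p.2 (codeword p.1 m + d n) v / ((q : ℝ) ^ k₁ n * (q : ℝ) ^ k₂ n)) B)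
  have hβ : 𝔼 p, β p = 𝔼 m, 𝔼 v,
      𝔼 H : Matrix (Fin (k₁ n - k₂ n)) (Fin (k₂ n)) (ZMod q),
      𝔼 Q : Matrix (Fin (n - k₁ n)) (MsgIdx (k₁ n) (k₂ n)) (ZMod q),
        ind (¬ExpClose n (ε / 2)
          (collisions Q H (codeword Q m + d n) v / ((q : ℝ) ^ k₁ n * (q : ℝ) ^ k₂ n)) B) := by
    rw [Finset.expect_comm]
    refine Finset.expect_congr rfl fun m _ => ?_
    rw [Finset.expect_comm]
    refine Finset.expect_congr rfl fun v _ => ?_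
    rw [← Finset.univ_product_univ, Finset.expect_product, Finset.expect_comm]
  rw [← hβ]
  refine (one_sub_le_expect_ind β (fun p => Finset.expect_nonneg fun _ _ =>
    Finset.expect_nonneg fun _ _ => ind_nonneg _) hη).trans ?_
  refine Finset.expect_le_expect fun p _ => ind_mono fun hp => ?_
  exact exists_typical_sumset p.1 p.2 (d n) (hk₂ n) hε.le hB0 hAB hn hp


theorem theorem2 (q : ℕ) [Fact q.Prime] (k₁ k₂ : ℕ → ℕ)
    (hk₂ : ∀ n, k₂ n ≤ k₁ n) (hk₁ : ∀ n, k₁ n ≤ n) (R₁ R₂ : ℝ)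
    (hR₁ : Tendsto (fun n : ℕ => (k₁ n : ℝ) / (n : ℝ) * Real.logb 2 (q : ℝ)) atTop (𝓝 R₁))
    (hR₂ : Tendsto (fun n : ℕ => (k₂ n : ℝ) / (n : ℝ) * Real.logb 2 (q : ℝ)) atTop (𝓝 R₂))
    (d : ∀ n : ℕ, CodeIdx n (k₁ n) (k₂ n) → ZMod q) :
    ∃ ε η : ℕ → ℝ, Antitone ε ∧ Tendsto ε atTop (𝓝 0) ∧ Tendsto η atTop (𝓝 0) ∧
      Tendsto (fun n : ℕ => ((ensemble q n (k₁ n) (k₂ n)).toOuterMeasure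
          {QH | ∃ K : Finset (CodeIdx n (k₁ n) (k₂ n) → ℤ),
            K ⊆ codeSumset QH.1 QH.2 (d n) ∧
            1 - η n ≤ ((inducedDist QH.1 QH.2 (d n)).toOuterMeasure (K : Set _)).toReal ∧
            ExpClose n (ε n) (K.card : ℝ)
              (min ((2 : ℝ) ^ ((n : ℝ) * (R₁ + R₂)))
                ((2 : ℝ) ^ ((n : ℝ) * (max R₁ R₂ + capD q)))) ∧
            ∀ w ∈ K, ExpClose n (ε n) (inducedDist QH.1 QH.2 (d n) w).toReal
              (max ((2 : ℝ) ^ (-((n : ℝ) * (R₁ + R₂))))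
                ((2 : ℝ) ^ (-((n : ℝ) * (max R₁ R₂ + capD q)))))}).toReal)
        atTop (𝓝 1) := by
  obtain ⟨ε, hanti, hlim, h⟩ := exists_antitone_tendsto_one _
    (fun _ _ => ENNReal.toReal_nonneg)
    (fun n ε => by
      rw [ensemble_toOuterMeasure]
      exact Finset.expect_le Finset.univ_nonempty fun _ _ => ind_le_one _)
    (fun ε hε => tendsto_ensemble_typical_sumset q k₁ k₂ hk₂ hk₁ R₁ R₂ hR₁ hR₂ d hε)
  -- One sequence serves both as exponent tolerance and as bound on the missing mass.
  exact ⟨ε, ε, hanti, hlim, hlim, h⟩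

end
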